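/- Let $\mathbb D$ be the open unit disc of $\mathbb C$, $\mathbb D^*=\mathbb D\setminus\{0\}$, $\alpha>-1$ and $-1<\beta\le 0$. Let $d\mu_{\alpha,\beta}(z)=\frac{1}{B(\alpha+1,\beta+1)}|z|^{2\beta}(1-|z|^2)^{\alpha}\,dA(z)$ on $\mathbb D$, where $B$ is the beta function and $dA$ is the area measure normalized by $A(\mathbb D)=1$. For $1\le p<\infty$ let $\mathcal A^p_{\alpha,\beta}$ be the space of holomorphic functions $f$ on $\mathbb D^*$ with $\|f\|_{\alpha,\beta,p}=\left(\int_{\mathbb D}|f|^p\,d\mu_{\alpha,\beta}\right)^{1/p}<\infty$. Let $Q_{\alpha,\beta}(\xi)=\sum_{n\ge 0}\frac{\beta}{n+\beta}\binom{\alpha+1}{n}(-\xi)^n$ for $\beta\neq 0$ and $Q_{\alpha,0}=1$, so that $\mathbb K_{\alpha,\beta}(w,z)=\frac{Q_{\alpha,\beta}(w\bar z)}{(1-w\bar z)^{\alpha+2}}$ is the reproducing kernel of $\mathcal A^2_{\alpha,\beta}$, and let $\mathcal J_\alpha$ be the set of all $\beta\in(-1,0]$ such that $Q_{\alpha,\beta}$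 has no zero in $\mathbb D$. Put $\varrho_{\alpha,\beta}(z)=\left(\frac{\partial^2}{\partial z\,\partial\bar z}\log\mathbb K_{\alpha,\beta}(z,z)\right)^{1/2}$ and, for $a,b\in\mathbb D$, let $\mathbf d_{\alpha,\beta}(a,b)$ be the infimum of $\int_0^1\varrho_{\alpha,\beta}(\gamma(s))|\gamma'(s)|\,ds$ over all piecewise continuously differentiable curves $\gamma:[0,1]\to\mathbb D$ from $a$ to $b$. Put $\mathbf D_{\alpha,\beta}(z,r)=\{w\in\mathbb D^*:\ \mathbf d_{\alpha,\beta}(w,z)<r\}$. A positive Borel measure $\nu$ on $\mathbb D$ is called a vanishing Carleson measure on $\mathcal A^p_{\alpha,\beta}$ if $\mathcal A^p_{\alpha,\beta}\subseteq L^p(\nu)$ (integrals of functions on $\mathbb D^*$ against $\nu$ being taken over $\mathbb D^*$) and the inclusion mapping $i_p:\mathcal A^p_{\alpha,\beta}\to L^p(\nu)$ is compact, in the case $p>1$, or, in the case $p=1$, $\|i_1(f_n)\|_{L^1(\nu)}\to 0$ for every sequence $(f_n)$ in $\mathcal A^1_{\alpha,\beta}$ that converges to $0$ in the weak-star topology.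 Here $\mathcal A^1_{\alpha,\beta}$ is identified with a subspace of the dual of $C_0(\mathbb D)$ through $f\mapsto f\,\mu_{\alpha,\beta}$, so that $f_n\to0$ weak-star means $\int_{\mathbb D} f_n g\,d\mu_{\alpha,\beta}\to 0$ for every $g\in C_0(\mathbb D)$. **Theorem.** Let $\alpha>-1$, $\beta\in\mathcal J_\alpha$, $1\le p<\infty$ and $r>0$, and let $\nu$ be a positive Borel measure on $\mathbb D$. If $\nu$ is a vanishing Carleson measure on $\mathcal A^p_{\alpha,\beta}$, then $$\lim_{|z|\to 1^-}\frac{\nu(\mathbf D_{\alpha,\beta}(z,r))}{\mu_{\alpha,\beta}(\mathbf D_{\alpha,\beta}(z,r))}=0 .$$ -/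

import Mathlib

open MeasureTheory Set Filter Topology
open scoped ENNReal Laplacian

noncomputable section

namespace ModifiedBergman

/-- The open unit disc `𝔻`. -/
def disc : Set ℂ := {z | ‖z‖ < 1}

/-- The punctured unit disc `𝔻* = 𝔻 ∖ {0}`. -/
def puncturedDisc : Set ℂ := {z | 0 < ‖z‖ ∧ ‖z‖ < 1}

theorem isOpen_puncturedDisc : IsOpen puncturedDisc :=
  (isOpen_lt continuous_const continuous_norm).inter (isOpen_lt continuous_norm continuous_const)

/-! ### The measure -/

/-- The density of `μ_{α,β}` with respect to Lebesgue measure on `𝔻`; the factor `π` is there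
because `dA` is the area measure normalized by `A(𝔻) = 1`. -/
def density (α β : ℝ) (z : ℂ) : ℝ :=
  ‖z‖ ^ (2 * β) * (1 - ‖z‖ ^ 2) ^ α / (Real.pi * ProbabilityTheory.beta (α + 1) (β + 1))

/-- `dμ_{α,β}(z) = B(α+1,β+1)⁻¹ |z|^{2β} (1-|z|²)^α dA(z)` on `𝔻`. -/
def mu (α β : ℝ) : Measure ℂ :=
  (volume.restrict disc).withDensity fun z => ENNReal.ofReal (density α β z)

/-! ### The modified Bergman spaces -/

/-- The functions in `𝒜^p_{α,β}`: holomorphic on `𝔻*` with finite `L^p(μ_{α,β})` norm. A function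
on `𝔻*` is represented by the function on `ℂ` that vanishes off `𝔻*`. -/
def bergmanSubmodule (α β : ℝ) (p : ℝ≥0∞) : Submodule ℂ (ℂ → ℂ) where
  carrier := {f | DifferentiableOn ℂ f puncturedDisc ∧ (∀ z ∉ puncturedDisc, f z = 0) ∧
    MemLp f p (mu α β)}
  add_mem' := fun {f g} hf hg =>
    ⟨hf.1.add hg.1, fun z hz => by simp [hf.2.1 z hz, hg.2.1 z hz], hf.2.2.add hg.2.2⟩
  zero_mem' := ⟨differentiableOn_const 0, fun _ _ => rfl, MemLp.zero⟩
  smul_mem' := fun c f hf =>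
    ⟨hf.1.const_smul c, fun z hz => by simp [hf.2.1 z hz], hf.2.2.const_smul c⟩

/-- The space `𝒜^p_{α,β}`. It is a type of its own so that its topology is the one of the
`L^p(μ_{α,β})` norm and not that of pointwise convergence. -/
def BergmanSpace (α β : ℝ) (p : ℝ≥0∞) : Type := ↥(bergmanSubmodule α β p)

instance (α β : ℝ) (p : ℝ≥0∞) : AddCommGroup (BergmanSpace α β p) :=
  inferInstanceAs (AddCommGroup ↥(bergmanSubmodule α β p))

instance (α β : ℝ) (p : ℝ≥0∞) : Module ℂ (BergmanSpace α β p) :=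
  inferInstanceAs (Module ℂ ↥(bergmanSubmodule α β p))

instance (α β : ℝ) (p : ℝ≥0∞) : CoeFun (BergmanSpace α β p) (fun _ => ℂ → ℂ) :=
  ⟨fun f => f.1⟩

/-- A function of `𝒜^p_{α,β}`, seen as a class in `L^p(μ_{α,β})`. -/
def toLpMu (α β : ℝ) (p : ℝ≥0∞) : BergmanSpace α β p →ₗ[ℂ] Lp ℂ p (mu α β) where
  toFun f := MemLp.toLp f f.2.2.2
  map_add' f g := MemLp.toLp_add f.2.2.2 g.2.2.2
  map_smul' c f := MemLp.toLp_const_smul c f.2.2.2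

/-- The norm of `𝒜^p_{α,β}` is the one of `L^p(μ_{α,β})`. -/
instance (α β : ℝ) (p : ℝ≥0∞) [Fact (1 ≤ p)] : SeminormedAddCommGroup (BergmanSpace α β p) :=
  SeminormedAddCommGroup.induced _ _ (toLpMu α β p)

instance (α β : ℝ) (p : ℝ≥0∞) [Fact (1 ≤ p)] : NormedSpace ℂ (BergmanSpace α β p) :=
  NormedSpace.induced ℂ _ _ (toLpMu α β p)

theorem norm_def {α β : ℝ} {p : ℝ≥0∞} [Fact (1 ≤ p)] (f : BergmanSpace α β p) :
    ‖f‖ = (eLpNorm f p (mu α β)).toReal :=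
  Lp.norm_toLp _ f.2.2.2

/-- For `α, β > -1` the seminorm above is a norm. -/
theorem eq_zero_of_norm_eq_zero {α β : ℝ} (hα : -1 < α) (hβ : -1 < β) {p : ℝ≥0∞}
    [Fact (1 ≤ p)] (f : BergmanSpace α β p) (hf : ‖f‖ = 0) : f = 0 := by
  have hp : p ≠ 0 := (zero_lt_one.trans_le (Fact.out : (1 : ℝ≥0∞) ≤ p)).ne'
  have h0 : eLpNorm f p (mu α β) = 0 := by
    rw [norm_def, ENNReal.toReal_eq_zero_iff] at hf
    exact hf.resolve_right f.2.2.2.2.ne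
  have h1 : (f : ℂ → ℂ) =ᵐ[mu α β] 0 := (eLpNorm_eq_zero_iff f.2.2.2.1 hp).1 h0
  have hm : Measurable (density α β) := by unfold density; fun_prop
  have h2 : (f : ℂ → ℂ) =ᵐ[volume.restrict puncturedDisc] 0 := by
    have h3 := (ae_withDensity_iff hm.ennreal_ofReal).1 h1
    have h4 := ae_restrict_of_ae_restrict_of_subset
      (fun z hz => hz.2 : puncturedDisc ⊆ disc) h3
    filter_upwards [h4, ae_restrict_mem isOpen_puncturedDisc.measurableSet] with z hz hzD
    refine hz (ENNReal.ofReal_pos.2 ?_).ne'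
    have hz1 : 0 < 1 - ‖z‖ ^ 2 := by nlinarith [hzD.1, hzD.2]
    have hB := ProbabilityTheory.beta_pos (show 0 < α + 1 by linarith) (show 0 < β + 1 by linarith)
    have := Real.rpow_pos_of_pos hzD.1 (2 * β)
    have := Real.rpow_pos_of_pos hz1 α
    unfold density
    positivity
  have h5 := Measure.eqOn_open_of_ae_eq h2 isOpen_puncturedDisc f.2.1.continuousOn
    continuousOn_const
  refine Subtype.ext (funext fun z => ?_)
  by_cases hz : z ∈ puncturedDisc
  · exact h5 hz
  · exact f.2.2.1 z hz

/-! ### Vanishing Carleson measures -/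

/-- `𝒜^p_{α,β} ⊆ L^p(ν)`. As functions in `𝒜^p_{α,β}` live on `𝔻*`, integrals against `ν` are
taken over `𝔻*`. -/
def IsIncluded (α β : ℝ) (p : ℝ≥0∞) (ν : Measure ℂ) : Prop :=
  ∀ f : BergmanSpace α β p, MemLp f p (ν.restrict puncturedDisc)

/-- The inclusion mapping `i_p : 𝒜^p_{α,β} → L^p(ν)`. -/
def inclusion {α β : ℝ} {p : ℝ≥0∞} {ν : Measure ℂ} (h : IsIncluded α β p ν) :
    BergmanSpace α β p →ₗ[ℂ] Lp ℂ p (ν.restrict puncturedDisc) where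
  toFun f := (h f).toLp f
  map_add' f g := MemLp.toLp_add (h f) (h g)
  map_smul' c f := MemLp.toLp_const_smul c (h f)

/-- `f n → 0` weak-star in `𝒜^1_{α,β}`, where `f` is identified with the measure `f μ_{α,β}` in
the dual of `C₀(𝔻)`: `∫ f n * g dμ_{α,β} → 0` for all `g ∈ C₀(𝔻)`, that is, for all continuous
`g` on `ℂ` that vanish off `𝔻`. -/
def WeakStarNull {α β : ℝ} {p : ℝ≥0∞} (f : ℕ → BergmanSpace α β p) : Prop :=
  ∀ g : C(ℂ, ℂ), (∀ z ∉ disc, g z = 0) →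
    Tendsto (fun n => ∫ z, f n z * g z ∂(mu α β)) atTop (𝓝 0)

/-- `ν` is a vanishing Carleson measure on `𝒜^p_{α,β}`: the inclusion `i_p` is (defined and)
compact if `p > 1`, and `∗`-compact if `p = 1`. -/
def IsVanishingCarleson (α β : ℝ) (p : ℝ≥0∞) [Fact (1 ≤ p)] (ν : Measure ℂ) : Prop :=
  ∃ h : IsIncluded α β p ν,
    (1 < p → IsCompactOperator (inclusion h)) ∧
    (p = 1 → ∀ f : ℕ → BergmanSpace α β p, WeakStarNull f →
      Tendsto (fun n => ‖inclusion h (f n)‖) atTop (𝓝 0))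

/-! ### The Bergman kernel and the modified Bergman-Poincaré metric, for `-1 < β ≤ 0` -/

/-- `Q_{α,β}(ξ) = ∑ₙ β (-ξ)ⁿ / (n + β) * binom(α+1, n)`, and `Q_{α,0} = 1`. -/
def Q (α β : ℝ) (ξ : ℂ) : ℂ :=
  if β = 0 then 1
  else ∑' n : ℕ, ((β / (n + β) * Ring.choose (α + 1) n : ℝ) : ℂ) * (-ξ) ^ n

/-- The set `𝒥_α` of those `β ∈ (-1, 0]` for which `Q_{α,β}` has no zero in `𝔻`. -/
def J (α : ℝ) : Set ℝ := {β | -1 < β ∧ β ≤ 0 ∧ ∀ ξ ∈ disc, Q α β ξ ≠ 0}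

/-- The reproducing kernel `𝕂_{α,β}(w,z) = Q_{α,β}(w z̄) / (1 - w z̄)^{α+2}` of `𝒜²_{α,β}`. -/
def kernel (α β : ℝ) (w z : ℂ) : ℂ :=
  Q α β (w * star z) / (1 - w * star z) ^ ((α + 2 : ℝ) : ℂ)

/-- `κ_{α,β}(z) = log 𝕂_{α,β}(z,z)`. -/
def kappa (α β : ℝ) (z : ℂ) : ℝ := Real.log (kernel α β z z).re

/-- `ϱ_{α,β}`, with `ϱ² = ∂²κ_{α,β}/∂z∂z̄ = Δκ_{α,β} / 4`. -/
def rho (α β : ℝ) (z : ℂ) : ℝ := Real.sqrt ((Δ (kappa α β)) z / 4)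

/-- `γ : [0,1] → 𝔻` is a piecewise continuously differentiable curve from `a` to `b`. -/
structure IsCurve (γ : ℝ → ℂ) (a b : ℂ) : Prop where
  source : γ 0 = a
  target : γ 1 = b
  mem_disc : ∀ s ∈ Icc (0 : ℝ) 1, γ s ∈ disc
  continuousOn : ContinuousOn γ (Icc 0 1)
  piecewise : ∃ (n : ℕ) (t : ℕ → ℝ), Monotone t ∧ t 0 = 0 ∧ t n = 1 ∧
    ∀ i < n, ContDiffOn ℝ 1 γ (Icc (t i) (t (i + 1)))

/-- `ℓ_{α,β}(γ) = ∫₀¹ ϱ_{α,β}(γ(s)) |γ'(s)| ds`. -/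
def length (α β : ℝ) (γ : ℝ → ℂ) : ℝ≥0∞ :=
  ∫⁻ s in Icc (0 : ℝ) 1, ENNReal.ofReal (rho α β (γ s) * ‖deriv γ s‖)

/-- The modified Bergman-Poincaré distance `d_{α,β}(a,b)`. -/
def dist (α β : ℝ) (a b : ℂ) : ℝ≥0∞ :=
  ⨅ (γ : ℝ → ℂ) (_ : IsCurve γ a b), length α β γ

/-- The modified Bergman disc `D_{α,β}(z,r) = {w ∈ 𝔻* : d_{α,β}(w,z) < r}`. -/
def bergmanDisc (α β : ℝ) (z : ℂ) (r : ℝ) : Set ℂ :=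
  {w | w ∈ puncturedDisc ∧ dist α β w z < ENNReal.ofReal r}

end ModifiedBergman

end

noncomputable section

namespace ModifiedBergman

/-! On the diagonal the kernel is `Q(|z|²) / (1-|z|²)^(α+2)`. Since `Q` is bounded below by a
positive constant on `[1/2, 1)`, it contributes to `ϱ²` only a term of lower order than
`(α+2)/(1-|z|²)²`. Hence `ϱ` is comparable to `1/(1-|z|)` near the circle (`exists_rho_bounds`), as
for the hyperbolic metric, and for `|z|` close to `1` the modified disc lies between Euclidean discs
of radii `ε(1-|z|)` and `M(1-|z|)` (`exists_ball_subset_bergmanDisc`,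
`exists_bergmanDisc_subset_ball`). The inner disc gives `μ(D(z,r)) ≥ c(1-|z|)^(α+2)`
(`exists_le_mu_ball`).

The measure `ν` is tested on `f_z(w) = (1-|z|)^(1/p) (1 - z̄w)^(-(α+3)/p)`. A Forelli-Rudin estimate
(`exists_lintegral_rpow_le`) bounds these functions in the Bergman space, and they tend to `0`
uniformly on smaller discs as `|z| → 1`. Compactness for `p > 1`, or weak-star convergence for `p =
1`, then forces `∫ |f_z|^p dν → 0` (`tendsto_lintegral_testFun`). On the outer disc `|1 - z̄w|` is
at most a multiple of `1-|z|`, so `|f_z|^p` is at least a multiple of `(1-|z|)^(-(α+2))`. Therefore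
`ν(D(z,r))/μ(D(z,r))` is bounded by a constant times `∫ |f_z|^p dν`. -/

/-! ### The function `Q` on `[0, 1)`: differential equation and lower bound. -/

/-- The function `Q_{α,β}` on the real axis. -/
def realQ (α β t : ℝ) : ℝ :=
  if β = 0 then 1 else ∑' n : ℕ, (β / (n + β) * Ring.choose (α + 1) n) * (-t) ^ n

theorem Q_ofReal (α β t : ℝ) : Q α β (t : ℂ) = (realQ α β t : ℂ) := by
  unfold Q realQ
  split_ifs
  · simp
  · push_cast
    rfl

theorem hasSum_choose_mul_pow (a : ℝ) {x : ℝ} (hx : |x| < 1) :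
    HasSum (fun n : ℕ => Ring.choose a n * x ^ n) ((1 + x) ^ a) := by
  have h := (Real.one_add_rpow_hasFPowerSeriesOnBall_zero (a := a)).hasSum (y := x)
    (by simpa [enorm_eq_nnnorm, ← NNReal.coe_lt_coe] using hx)
  simpa [binomialSeries, FormalMultilinearSeries.coeff_ofScalars, mul_comm] using h

theorem summable_abs_choose_mul_pow (a : ℝ) {ρ : ℝ} (h0 : 0 ≤ ρ) (h1 : ρ < 1) :
    Summable fun n : ℕ => |Ring.choose a n| * ρ ^ n := by
  have h := (hasSum_choose_mul_pow a (x := ρ) (by rwa [abs_of_nonneg h0])).summable.abs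
  simpa [abs_mul, abs_of_nonneg h0] using h

theorem natCast_add_ne_zero {β : ℝ} (h1 : -1 < β) (h0 : β ≠ 0) (n : ℕ) : (n : ℝ) + β ≠ 0 := by
  rcases n with _ | n
  · simpa using h0
  · push_cast
    have : (0 : ℝ) ≤ n := n.cast_nonneg
    linarith

/-- Uniformity in `n` lets the binomial series dominate the series of `Q`. The term `n = 0` is at
most `1`, and for later terms `n + β ≥ 1 + β`. -/
theorem abs_div_natCast_add_le {β : ℝ} (h1 : -1 < β) (n : ℕ) :
    |β / (n + β)| ≤ 1 + |β| / (1 + β) := by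
  have hb : 0 < 1 + β := by linarith
  have hq : 0 ≤ |β| / (1 + β) := by positivity
  rcases n with _ | n
  · rcases eq_or_ne β 0 with rfl | h
    · simp
    · simp only [Nat.cast_zero, zero_add, div_self h, abs_one]
      linarith
  · have hn : (0 : ℝ) ≤ n := n.cast_nonneg
    push_cast
    rw [abs_div, abs_of_pos (by linarith : 0 < (n : ℝ) + 1 + β)]
    have : |β| / (n + 1 + β) ≤ |β| / (1 + β) := by gcongr; linarith
    linarith

/-- The denominator `n + β` absorbs the factor `n` produced by differentiation; this is the source
of the differential equation for `Q`. -/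
theorem natCast_mul_div_add {β : ℝ} (h1 : -1 < β) (h0 : β ≠ 0) (n : ℕ) :
    (n : ℝ) * (β / (n + β)) = β * (1 - β / (n + β)) := by
  have := natCast_add_ne_zero h1 h0 n
  field_simp
  ring

theorem summable_realQ (α : ℝ) {β : ℝ} (h1 : -1 < β) {t : ℝ} (ht : |t| < 1) :
    Summable fun n : ℕ => (β / (n + β) * Ring.choose (α + 1) n) * (-t) ^ n := by
  have hs := (summable_abs_choose_mul_pow (α + 1) (abs_nonneg t) ht).mul_left
    (1 + |β| / (1 + β))
  refine Summable.of_norm_bounded hs fun n => ?_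
  rw [Real.norm_eq_abs, abs_mul, abs_mul, abs_pow, abs_neg, mul_assoc]
  gcongr
  exact abs_div_natCast_add_le h1 n

theorem hasDerivAt_tsum_mul_neg_pow (a : ℕ → ℝ) {ρ t : ℝ} (hρ : 0 < ρ) (ht : |t| < ρ)
    (hs : Summable fun n : ℕ => |n * a n| * ρ ^ n) (h0 : Summable fun n : ℕ => a n * (-t) ^ n) :
    HasDerivAt (fun y : ℝ => ∑' n : ℕ, a n * (-y) ^ n)
      (∑' n : ℕ, a n * (n * (-t) ^ (n - 1) * (-1))) t := by
  have ht' := abs_lt.1 ht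
  refine hasDerivAt_tsum_of_isPreconnected (t := Ioo (-ρ) ρ) (y₀ := t)
    (u := fun n => ρ⁻¹ * (|n * a n| * ρ ^ n))
    (g := fun (n : ℕ) (y : ℝ) => a n * (-y) ^ n)
    (g' := fun (n : ℕ) (y : ℝ) => a n * (n * (-y) ^ (n - 1) * (-1)))
    (hs.mul_left _) isOpen_Ioo
    isPreconnected_Ioo (fun n y _ => ?_) (fun n y hy => ?_) ht' h0 ht'
  · exact ((hasDerivAt_neg y).pow n).const_mul _
  · have hy' : |y| ≤ ρ := (abs_lt.2 hy).le
    rcases n with _ | n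
    · simp
    · have e : a (n + 1) * ((n + 1 : ℕ) * (-y) ^ (n + 1 - 1) * (-1))
          = -(((n + 1 : ℕ) * a (n + 1)) * (-y) ^ n) := by
        rw [Nat.add_sub_cancel]; ring
      rw [e, norm_neg, Real.norm_eq_abs, abs_mul, abs_pow, abs_neg]
      calc |((n + 1 : ℕ) : ℝ) * a (n + 1)| * |y| ^ n
          ≤ |((n + 1 : ℕ) : ℝ) * a (n + 1)| * ρ ^ n := by gcongr
        _ = _ := by rw [pow_succ]; field_simp

/-- `Q` satisfies `t Q' = β ((1 - t)^{α+1} - Q)`. -/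
theorem hasDerivAt_realQ (α : ℝ) {β : ℝ} (h1 : -1 < β) {t : ℝ} (h0 : 0 < t) (ht : t < 1) :
    HasDerivAt (realQ α β) (β * ((1 - t) ^ (α + 1) - realQ α β t) / t) t := by
  rcases eq_or_ne β 0 with rfl | hβ
  · have : realQ α 0 = fun _ => 1 := by funext t; simp [realQ]
    rw [this]
    simpa using hasDerivAt_const t (1 : ℝ)
  obtain ⟨ρ, hρt, hρ1⟩ := exists_between ht
  have hρ0 : 0 < ρ := h0.trans hρt
  have ht' : |t| < 1 := by rwa [abs_of_pos h0]
  set a : ℕ → ℝ := fun n => β / (n + β) * Ring.choose (α + 1) n with ha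
  have hn : ∀ n : ℕ, n * a n = β * (1 - β / (n + β)) * Ring.choose (α + 1) n := fun n => by
    rw [ha, ← natCast_mul_div_add h1 hβ n]; ring
  have hs : Summable fun n : ℕ => |n * a n| * ρ ^ n := by
    refine Summable.of_nonneg_of_le (fun n => by positivity) (fun n => ?_)
      ((summable_abs_choose_mul_pow (α + 1) hρ0.le hρ1).mul_left
        (|β| * (1 + (1 + |β| / (1 + β)))))
    rw [hn, abs_mul, abs_mul, ← mul_assoc]
    gcongr
    refine (abs_sub _ _).trans ?_
    rw [abs_one]
    gcongr
    exact abs_div_natCast_add_le h1 n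
  have key := hasDerivAt_tsum_mul_neg_pow a hρ0 (by rwa [abs_of_pos h0]) hs
    (summable_realQ α h1 ht')
  have hq : realQ α β = fun y : ℝ => ∑' n : ℕ, a n * (-y) ^ n := by
    funext z; simp only [realQ, hβ, if_false, ha]
  have hA := hasSum_choose_mul_pow (α + 1) (x := -t) (by rwa [abs_neg])
  have hB := (summable_realQ α h1 ht').hasSum
  -- Since `n aₙ = β (binom(α+1, n) - aₙ)`, the series of `t Q'` is `β` times the difference of the
  -- binomial series and `Q`.
  have hC := ((hA.sub hB).mul_left β).div_const t
  have hqt : (∑' n : ℕ, (β / (n + β) * Ring.choose (α + 1) n) * (-t) ^ n) = realQ α β t := by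
    rw [hq]
  rw [hqt, ← sub_eq_add_neg] at hC
  rw [← hC.tsum_eq]
  rw [hq]
  convert key using 1
  refine tsum_congr fun n => ?_
  rcases n with _ | n
  · simp [hβ]
  · have e := hn (n + 1)
    have : a (n + 1) * ((n + 1 : ℕ) * (-t) ^ (n + 1 - 1) * (-1))
        = -(((n + 1 : ℕ) * a (n + 1)) * (-t) ^ n) := by
      rw [Nat.add_sub_cancel]; ring
    rw [this, e, pow_succ]
    field_simp
    ring

theorem realQ_zero (α β : ℝ) : realQ α β 0 = 1 := by
  unfold realQ
  split_ifs with h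
  · rfl
  · rw [tsum_eq_single 0 fun n hn => by simp [hn]]
    simp [h]

/-- The differential equation divides by `t`, so the origin is treated directly from the series. -/
theorem differentiableAt_realQ_zero (α : ℝ) {β : ℝ} (h1 : -1 < β) :
    DifferentiableAt ℝ (realQ α β) 0 := by
  rcases eq_or_ne β 0 with rfl | hβ
  · have : realQ α 0 = fun _ => 1 := by funext t; simp [realQ]
    rw [this]
    exact differentiableAt_const _
  set a : ℕ → ℝ := fun n => β / (n + β) * Ring.choose (α + 1) n with ha
  have hs : Summable fun n : ℕ => |n * a n| * (1 / 2 : ℝ) ^ n := by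
    refine Summable.of_nonneg_of_le (fun n => by positivity) (fun n => ?_)
      ((summable_abs_choose_mul_pow (α + 1) (ρ := 1 / 2) (by norm_num) (by norm_num)).mul_left
        (|β| * (1 + (1 + |β| / (1 + β)))))
    rw [show n * a n = β * (1 - β / (n + β)) * Ring.choose (α + 1) n by
      rw [ha, ← natCast_mul_div_add h1 hβ n]; ring, abs_mul, abs_mul, ← mul_assoc]
    gcongr
    refine (abs_sub _ _).trans ?_
    rw [abs_one]
    gcongr
    exact abs_div_natCast_add_le h1 n
  have key := hasDerivAt_tsum_mul_neg_pow a (ρ := 1 / 2) (t := 0) (by norm_num) (by norm_num) hs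
    (summable_realQ α h1 (by norm_num))
  have hq : realQ α β = fun y : ℝ => ∑' n : ℕ, a n * (-y) ^ n := by
    funext z; simp only [realQ, hβ, if_false, ha]
  rw [hq]
  exact key.differentiableAt

theorem hasDerivAt_one_sub_rpow (a : ℝ) {t : ℝ} (ht : t < 1) :
    HasDerivAt (fun t : ℝ => (1 - t) ^ a) (-(a * (1 - t) ^ (a - 1))) t := by
  have h := ((hasDerivAt_id t).const_sub 1).rpow_const (p := a) (Or.inl (by simp; linarith))
  simpa using h

/-- The function `t^β (Q - (1-t)^{α+2})` has derivative `(α + β + 2) t^β (1-t)^{α+1}`. -/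
theorem hasDerivAt_rpow_mul_realQ_sub (α : ℝ) {β : ℝ} (h1 : -1 < β) {t : ℝ} (h0 : 0 < t)
    (ht : t < 1) :
    HasDerivAt (fun t => t ^ β * (realQ α β t - (1 - t) ^ (α + 2)))
      ((α + β + 2) * (t ^ β * (1 - t) ^ (α + 1))) t := by
  have hA := Real.hasDerivAt_rpow_const (x := t) (p := β) (Or.inl h0.ne')
  have hB := hasDerivAt_one_sub_rpow (α + 2) ht
  refine (hA.mul ((hasDerivAt_realQ α h1 h0 ht).sub hB)).congr_deriv ?_
  have e1 : (1 - t) ^ (α + 2) = (1 - t) ^ (α + 1) * (1 - t) := by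
    rw [← Real.rpow_add_one (by linarith)]; ring_nf
  have e2 : t ^ (β - 1) = t ^ β / t := Real.rpow_sub_one h0.ne' β
  rw [show α + 2 - 1 = α + 1 by ring]
  simp only [e1, e2, Pi.sub_apply]
  field_simp
  ring

/-- The function `N = t^β (Q - (1-t)^(α+2))` is strictly increasing and tends to `0` at the origin,
so it is positive; undoing the factor `t^β` bounds `Q` from below. -/
theorem exists_pos_le_realQ {α β : ℝ} (hα : -1 < α) (h1 : -1 < β) (hβ : β ≤ 0) :
    ∃ q₀ > 0, ∀ t ∈ Ico (1 / 2 : ℝ) 1, q₀ ≤ realQ α β t := by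
  set N : ℝ → ℝ := fun t => t ^ β * (realQ α β t - (1 - t) ^ (α + 2)) with hN
  have hd : ∀ t ∈ Ioo (0 : ℝ) 1, HasDerivAt N ((α + β + 2) * (t ^ β * (1 - t) ^ (α + 1))) t :=
    fun t ht => hasDerivAt_rpow_mul_realQ_sub α h1 ht.1 ht.2
  have hmono : StrictMonoOn N (Ioo 0 1) := by
    refine strictMonoOn_of_deriv_pos (convex_Ioo 0 1)
      (fun t ht => (hd t ht).continuousAt.continuousWithinAt) fun t ht => ?_
    rw [interior_Ioo] at ht
    rw [(hd t ht).deriv]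
    have := Real.rpow_pos_of_pos ht.1 β
    have := Real.rpow_pos_of_pos (sub_pos.2 ht.2) (α + 1)
    have : 0 < α + β + 2 := by linarith
    positivity
  have hlim : Tendsto N (𝓝[>] 0) (𝓝 0) := by
    -- `Q - (1-t)^(α+2)` vanishes at `0` and is differentiable there, so `N` is `t^(β+1)` times a
    -- convergent slope.
    have hD := (differentiableAt_realQ_zero α h1).hasDerivAt.sub
      (hasDerivAt_one_sub_rpow (α + 2) (t := 0) one_pos)
    rw [hasDerivAt_iff_tendsto_slope] at hD
    have hD' := hD.mono_left (nhdsWithin_mono 0 (fun x (hx : 0 < x) => hx.ne'))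
    have hr : Tendsto (fun t : ℝ => t ^ (β + 1)) (𝓝[>] 0) (𝓝 0) := by
      have := (Real.continuousAt_rpow_const 0 (β + 1) (Or.inr (by linarith))).tendsto
      rw [Real.zero_rpow (by linarith)] at this
      exact this.mono_left nhdsWithin_le_nhds
    have := hr.mul hD'
    rw [zero_mul] at this
    refine this.congr' ?_
    filter_upwards [self_mem_nhdsWithin] with t (ht : 0 < t)
    simp only [slope, Pi.sub_apply, realQ_zero, sub_zero, Real.one_rpow, sub_self, vsub_eq_sub,
      smul_eq_mul, hN]
    rw [Real.rpow_add_one ht.ne']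
    field_simp
  -- The limit at `0` gives only a weak inequality; passing from `1/4` to `1/2` makes it strict.
  have h4 : 0 ≤ N (1 / 4) := by
    refine le_of_tendsto hlim ?_
    filter_upwards [Ioo_mem_nhdsGT (show (0 : ℝ) < 1 / 4 by norm_num)] with t ht
    exact (hmono ⟨ht.1, by linarith [ht.2]⟩ ⟨by norm_num, by norm_num⟩ ht.2).le
  have h2 : 0 < N (1 / 2) := h4.trans_lt
    (hmono ⟨by norm_num, by norm_num⟩ ⟨by norm_num, by norm_num⟩ (by norm_num))
  refine ⟨(1 / 2 : ℝ) ^ (-β) * N (1 / 2), by positivity, fun t ht => ?_⟩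
  have ht0 : 0 < t := by linarith [ht.1]
  have hle : N (1 / 2) ≤ N t :=
    hmono.monotoneOn ⟨by norm_num, by norm_num⟩ ⟨ht0, ht.2⟩ ht.1
  have hr : (1 / 2 : ℝ) ^ (-β) ≤ t ^ (-β) :=
    Real.rpow_le_rpow (by norm_num) ht.1 (by linarith)
  have hp : 0 ≤ (1 - t) ^ (α + 2) := Real.rpow_nonneg (by linarith [ht.2]) _
  calc (1 / 2 : ℝ) ^ (-β) * N (1 / 2) ≤ t ^ (-β) * N t := by gcongr
    _ = realQ α β t - (1 - t) ^ (α + 2) := by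
      simp only [hN]
      rw [← mul_assoc, ← Real.rpow_add ht0]
      simp
    _ ≤ realQ α β t := by linarith

/-! ### The size of `ϱ` near the unit circle. -/

/-- The Laplacian of a radial function. -/
theorem laplacian_comp_norm_sq {Φ φ : ℝ → ℝ} {φ' : ℝ} {z : ℂ}
    (h1 : ∀ᶠ t in 𝓝 (‖z‖ ^ 2), HasDerivAt Φ (φ t) t) (h2 : HasDerivAt φ φ' (‖z‖ ^ 2)) :
    (Δ fun w : ℂ => Φ (‖w‖ ^ 2)) z = 4 * (φ (‖z‖ ^ 2) + ‖z‖ ^ 2 * φ') := by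
  have hn : ∀ w : ℂ, HasFDerivAt (fun w : ℂ => ‖w‖ ^ 2) (2 • innerSL ℝ w) w := fun w =>
    (hasStrictFDerivAt_norm_sq w).hasFDerivAt
  have hc : ContinuousAt (fun w : ℂ => ‖w‖ ^ 2) z := (hn z).continuousAt
  have hf : fderiv ℝ (fun w : ℂ => Φ (‖w‖ ^ 2)) =ᶠ[𝓝 z]
      fun w => φ (‖w‖ ^ 2) • (2 • innerSL ℝ w) := by
    filter_upwards [hc.eventually h1] with w hw
    exact (hw.comp_hasFDerivAt w (hn w)).fderiv
  have hg : HasFDerivAt (fun w : ℂ => φ (‖w‖ ^ 2) • (2 • innerSL ℝ w))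
      (φ (‖z‖ ^ 2) • (2 • (innerSL ℝ : ℂ →L[ℝ] ℂ →L[ℝ] ℝ))
        + (φ' • (2 • innerSL ℝ z)).smulRight (2 • innerSL ℝ z)) z :=
    (h2.comp_hasFDerivAt z (hn z)).smul ((innerSL ℝ : ℂ →L[ℝ] ℂ →L[ℝ] ℝ).hasFDerivAt.const_smul 2)
  have h := hg.congr_of_eventuallyEq hf
  rw [InnerProductSpace.laplacian_eq_iteratedFDeriv_complexPlane]
  simp only [iteratedFDeriv_two_apply, h.fderiv]
  have e : ‖z‖ ^ 2 = z.re * z.re + z.im * z.im := by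
    rw [Complex.sq_norm, Complex.normSq_apply]
  have e1 : innerSL ℝ (1 : ℂ) 1 = 1 := by rw [innerSL_apply_apply]; simp
  have e2 : innerSL ℝ Complex.I Complex.I = 1 := by rw [innerSL_apply_apply]; simp
  simp [Complex.inner, e1, e2]
  rw [e]
  ring

theorem kernel_self (α β : ℝ) {z : ℂ} (hz : ‖z‖ < 1) :
    kernel α β z z = ((realQ α β (‖z‖ ^ 2) / (1 - ‖z‖ ^ 2) ^ (α + 2) : ℝ) : ℂ) := by
  have e : z * star z = ((‖z‖ ^ 2 : ℝ) : ℂ) := by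
    rw [Complex.star_def, Complex.mul_conj, Complex.normSq_eq_norm_sq]
  have h1 : 0 ≤ 1 - ‖z‖ ^ 2 := by nlinarith [norm_nonneg z]
  unfold kernel
  rw [e, Q_ofReal, Complex.ofReal_div, Complex.ofReal_cpow h1]
  push_cast
  rfl

theorem kappa_eq (α β : ℝ) {z : ℂ} (hz : ‖z‖ < 1) (hq : 0 < realQ α β (‖z‖ ^ 2)) :
    kappa α β z
      = Real.log (realQ α β (‖z‖ ^ 2)) - (α + 2) * Real.log (1 - ‖z‖ ^ 2) := by
  have h1 : 0 < 1 - ‖z‖ ^ 2 := by nlinarith [norm_nonneg z]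
  unfold kappa
  rw [kernel_self α β hz, Complex.ofReal_re, Real.log_div hq.ne' (by positivity),
    Real.log_rpow h1]

/-- The value of `ϱ² - (α + 2) / (1 - |z|²)²` as a function of `t = |z|²`. -/
def rhoError (α β t : ℝ) : ℝ :=
  β * (-((α + 1) * (1 - t) ^ α) / realQ α β t
    - (1 - t) ^ (α + 1) * (β * ((1 - t) ^ (α + 1) - realQ α β t) / t) / realQ α β t ^ 2)

theorem laplacian_kappa {α β : ℝ} (h1 : -1 < β) {z : ℂ} (hz0 : 0 < ‖z‖) (hz : ‖z‖ < 1)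
    (hq : 0 < realQ α β (‖z‖ ^ 2)) :
    (Δ (kappa α β)) z / 4 = rhoError α β (‖z‖ ^ 2) + (α + 2) / (1 - ‖z‖ ^ 2) ^ 2 := by
  set t₀ := ‖z‖ ^ 2 with ht₀
  have ht0 : 0 < t₀ := by positivity
  have ht1 : t₀ < 1 := by nlinarith
  set φ : ℝ → ℝ := fun t =>
    (β * ((1 - t) ^ (α + 1) / realQ α β t - 1) + (α + 2) * (t / (1 - t))) / t with hφ
  have hev : ∀ᶠ t in 𝓝 t₀, 0 < realQ α β t :=
    (hasDerivAt_realQ α h1 ht0 ht1).continuousAt.eventually (lt_mem_nhds hq)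
  have hΦ : ∀ᶠ t in 𝓝 t₀, HasDerivAt
      (fun t => Real.log (realQ α β t) - (α + 2) * Real.log (1 - t)) (φ t) t := by
    filter_upwards [hev, Ioo_mem_nhds ht0 ht1] with t hqt ht
    have hA := (hasDerivAt_realQ α h1 ht.1 ht.2).log hqt.ne'
    have h1t : 1 - t ≠ 0 := by linarith [ht.2]
    have hB := (((hasDerivAt_id t).const_sub 1).log h1t).const_mul (α + 2)
    refine (hA.sub hB).congr_deriv ?_
    have := ht.1.ne'
    simp only [hφ, id]
    field_simp
    ring
  have h1t : 1 - t₀ ≠ 0 := by linarith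
  set ψ' := rhoError α β t₀ + (α + 2) / (1 - t₀) ^ 2 with hψ'
  -- A quarter of the radial Laplacian is `φ + tφ' = (tφ)'`; the function differentiated here is
  -- `tφ`.
  have hψ : HasDerivAt
      (fun t => β * ((1 - t) ^ (α + 1) / realQ α β t - 1) + (α + 2) * (t / (1 - t))) ψ' t₀ := by
    have hA := (((hasDerivAt_one_sub_rpow (α + 1) ht1).div
      (hasDerivAt_realQ α h1 ht0 ht1) hq.ne').sub_const 1).const_mul β
    have hB := ((hasDerivAt_id t₀).div ((hasDerivAt_id t₀).const_sub 1) h1t).const_mul (α + 2)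
    refine (hA.add hB).congr_deriv ?_
    simp only [hψ', rhoError, id]
    rw [show α + 1 - 1 = α by ring]
    have := hq.ne'
    field_simp
    ring
  have hφ' := hψ.div (hasDerivAt_id t₀) ht0.ne'
  have hL := laplacian_comp_norm_sq hΦ hφ'
  have hk : kappa α β =ᶠ[𝓝 z] fun w : ℂ =>
      Real.log (realQ α β (‖w‖ ^ 2)) - (α + 2) * Real.log (1 - ‖w‖ ^ 2) := by
    have hc : ContinuousAt (fun w : ℂ => ‖w‖ ^ 2) z := by fun_prop
    filter_upwards [hc.eventually hev, continuous_norm.continuousAt.eventually (gt_mem_nhds hz)]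
      with w hw hw1
    exact kappa_eq α β hw1 hw
  rw [(InnerProductSpace.laplacian_congr_nhds hk).self_of_nhds, hL]
  simp only [hφ, id, ← ht₀]
  field_simp
  ring

/-- With `Q` bounded below, the error is at most a constant times `(1-t)^α` plus a constant, and `α
+ 2 > 0`. -/
theorem tendsto_one_sub_sq_mul_rhoError {α β : ℝ} (hα : -1 < α) (h1 : -1 < β) (hβ : β ≤ 0) :
    Tendsto (fun t => (1 - t) ^ 2 * rhoError α β t) (𝓝[<] 1) (𝓝 0) := by
  obtain ⟨q₀, hq₀, hq⟩ := exists_pos_le_realQ hα h1 hβ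
  set A := |β| * (α + 1) / q₀
  set B := |β| * (2 * |β| * (1 / q₀ ^ 2 + 1 / q₀))
  have hlim : Tendsto (fun t : ℝ => A * (1 - t) ^ (α + 2) + B * (1 - t) ^ 2) (𝓝[<] 1) (𝓝 0) := by
    have hc : ContinuousAt (fun t : ℝ => A * (1 - t) ^ (α + 2) + B * (1 - t) ^ 2) 1 := by
      have : ContinuousAt (fun t : ℝ => (1 - t) ^ (α + 2)) 1 :=
        (continuousAt_const.sub continuousAt_id).rpow_const (Or.inr (by linarith))
      fun_prop
    have := hc.tendsto
    simp only [sub_self, Real.zero_rpow (show α + 2 ≠ 0 by linarith)] at this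
    norm_num at this
    exact this.mono_left nhdsWithin_le_nhds
  refine squeeze_zero_norm' ?_ hlim
  filter_upwards [Ioo_mem_nhdsLT (show (1 / 2 : ℝ) < 1 by norm_num)] with t ht
  have hQ := hq t ⟨ht.1.le, ht.2⟩
  set q := realQ α β t
  have hq0 : 0 < q := hq₀.trans_le hQ
  have hs : 0 < 1 - t := by linarith [ht.2]
  have hs1 : 1 - t ≤ 1 := by linarith [ht.1]
  have ht0 : 0 < t := by linarith [ht.1]
  have hp1 : 0 < (1 - t) ^ (α + 1) := by positivity
  have hp2 : (1 - t) ^ (α + 1) ≤ 1 := Real.rpow_le_one hs.le hs1 (by linarith)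
  have e2 : (1 - t) ^ (α + 2) = (1 - t) ^ 2 * (1 - t) ^ α := by
    rw [show α + 2 = α + (2 : ℕ) by norm_num, Real.rpow_add_natCast hs.ne']; ring
  have hpα : 0 < (1 - t) ^ α := by positivity
  have hα1 : 0 < α + 1 := by linarith
  have b1 : |(-((α + 1) * (1 - t) ^ α) / q)| ≤ (α + 1) / q₀ * (1 - t) ^ α := by
    rw [abs_div, abs_neg, abs_of_pos (by positivity), abs_of_pos hq0, div_mul_eq_mul_div]
    gcongr
  have b2 : |(1 - t) ^ (α + 1) * (β * ((1 - t) ^ (α + 1) - q) / t) / q ^ 2|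
      ≤ 2 * |β| * (1 / q₀ ^ 2 + 1 / q₀) := by
    have hd : |(1 - t) ^ (α + 1) - q| ≤ 1 + q := by
      rw [abs_le]; constructor <;> linarith
    have ht2 : 1 / t ≤ 2 := by rw [div_le_iff₀ ht0]; linarith [ht.1]
    rw [abs_div, abs_mul, abs_div, abs_mul, abs_of_pos hp1, abs_of_pos ht0,
      abs_of_pos (by positivity : 0 < q ^ 2)]
    calc (1 - t) ^ (α + 1) * (|β| * |(1 - t) ^ (α + 1) - q| / t) / q ^ 2
        ≤ 1 * (|β| * (1 + q) / t) / q ^ 2 := by gcongr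
      _ = (1 / t) * |β| * (1 / q ^ 2 + 1 / q) := by field_simp
      _ ≤ _ := by gcongr
  rw [Real.norm_eq_abs, abs_mul, abs_of_pos (by positivity : 0 < (1 - t) ^ 2), rhoError, abs_mul]
  calc (1 - t) ^ 2 * (|β| * |(-((α + 1) * (1 - t) ^ α) / q)
        - (1 - t) ^ (α + 1) * (β * ((1 - t) ^ (α + 1) - q) / t) / q ^ 2|)
      ≤ (1 - t) ^ 2 * (|β| * ((α + 1) / q₀ * (1 - t) ^ α + 2 * |β| * (1 / q₀ ^ 2 + 1 / q₀))) := by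
        gcongr
        exact (abs_sub _ _).trans (add_le_add b1 b2)
    _ = A * (1 - t) ^ (α + 2) + B * (1 - t) ^ 2 := by
        rw [e2]; simp only [A, B]; ring

/-- Near the unit circle, `ϱ` is comparable to `1 / (1 - |z|)`. -/
theorem exists_rho_bounds {α β : ℝ} (hα : -1 < α) (h1 : -1 < β) (hβ : β ≤ 0) :
    ∃ R c C : ℝ, 0 < R ∧ R < 1 ∧ 0 < c ∧ 0 < C ∧ ∀ z : ℂ, R ≤ ‖z‖ → ‖z‖ < 1 →
      c / (1 - ‖z‖) ≤ rho α β z ∧ rho α β z ≤ C / (1 - ‖z‖) := by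
  obtain ⟨q₀, hq₀, hq⟩ := exists_pos_le_realQ hα h1 hβ
  have hα2 : 0 < α + 2 := by linarith
  have hev := (tendsto_one_sub_sq_mul_rhoError hα h1 hβ).eventually
    (Ioo_mem_nhds (show -((α + 2) / 2) < 0 by linarith) (show 0 < α + 2 by linarith))
  obtain ⟨T, hT, hT'⟩ := (mem_nhdsLT_iff_exists_Ioo_subset).1 hev
  have hT1 : T < 1 := hT
  set S := max ((T + 1) / 2) (1 / 2) with hS
  have hS1 : S < 1 := max_lt (by linarith) (by norm_num)
  have hS2 : 1 / 2 ≤ S := le_max_right _ _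
  have hS3 : T < S := lt_of_lt_of_le (by linarith) (le_max_left _ _)
  -- Near the circle `(1-t)² ϱ²` lies between `(α+2)/2` and `2(α+2)`. Replacing `1-t` by `1-|z|`
  -- costs a factor between `1` and `2`, which turns the lower constant into `(α+2)/8` after
  -- squaring.
  refine ⟨√S, √((α + 2) / 8), √(2 * (α + 2)), by positivity,
    by rw [Real.sqrt_lt' one_pos]; simpa using hS1, by positivity, by positivity, fun z hz hz1 => ?_⟩
  set t := ‖z‖ ^ 2 with ht
  have htS : S ≤ t := by
    rw [ht]; exact (Real.sqrt_le_left (norm_nonneg z)).1 hz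
  have hz0 : 0 < ‖z‖ := (Real.sqrt_pos.2 (by linarith)).trans_le hz
  have ht1 : t < 1 := by nlinarith
  have hE := hT' (show t ∈ Ioo T 1 from ⟨by linarith, ht1⟩)
  have hQ : 0 < realQ α β t := hq₀.trans_le (hq t ⟨by linarith, ht1⟩)
  have hL := laplacian_kappa (α := α) h1 hz0 hz1 hQ
  have hE1 : -((α + 2) / 2) < (1 - t) ^ 2 * rhoError α β t := hE.1
  have hE2 : (1 - t) ^ 2 * rhoError α β t < α + 2 := hE.2
  have hs : 0 < 1 - t := by linarith
  have hd : 0 < 1 - ‖z‖ := by linarith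
  have hst : 1 - t ≤ 2 * (1 - ‖z‖) := by nlinarith
  have hst' : 1 - ‖z‖ ≤ 1 - t := by nlinarith
  have hval : (Δ (kappa α β)) z / 4
      = ((1 - t) ^ 2 * rhoError α β t + (α + 2)) / (1 - t) ^ 2 := by
    rw [hL, ← ht]; field_simp
  unfold rho
  rw [hval]
  constructor
  · apply Real.le_sqrt_of_sq_le
    rw [div_pow, Real.sq_sqrt (by positivity), div_le_div_iff₀ (by positivity) (by positivity)]
    calc (α + 2) / 8 * (1 - t) ^ 2 ≤ (α + 2) / 8 * (2 * (1 - ‖z‖)) ^ 2 := by gcongr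
      _ = (α + 2) / 2 * (1 - ‖z‖) ^ 2 := by ring
      _ ≤ _ := by gcongr; linarith
  · rw [Real.sqrt_le_left (by positivity)]
    rw [div_pow, Real.sq_sqrt (by positivity)]
    gcongr
    linarith

/-! ### Comparison of modified Bergman discs with Euclidean discs. -/

theorem isCurve_segment {w z : ℂ} (h : segment ℝ w z ⊆ disc) :
    IsCurve (AffineMap.lineMap w z : ℝ → ℂ) w z where
  source := AffineMap.lineMap_apply_zero _ _
  target := AffineMap.lineMap_apply_one _ _
  mem_disc s hs := h (by rw [segment_eq_image_lineMap]; exact ⟨s, hs, rfl⟩)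
  continuousOn := (AffineMap.lineMap_continuous).continuousOn
  piecewise := by
    refine ⟨1, fun i => i, Nat.mono_cast, by simp, by simp, fun i _ => ?_⟩
    have : ContDiff ℝ 1 (AffineMap.lineMap w z : ℝ → ℂ) := by
      have e : (AffineMap.lineMap w z : ℝ → ℂ) = fun s : ℝ => s • (z - w) + w := by
        funext s; simp [AffineMap.lineMap_apply]
      rw [e]
      fun_prop
    exact this.contDiffOn

theorem dist_le_of_segment {α β B : ℝ} {w z : ℂ} (h : segment ℝ w z ⊆ disc)
    (hB : ∀ ζ ∈ segment ℝ w z, rho α β ζ ≤ B) :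
    dist α β w z ≤ ENNReal.ofReal (B * ‖z - w‖) := by
  refine (iInf₂_le (f := fun γ (_ : IsCurve γ w z) => length α β γ) _ (isCurve_segment h)).trans ?_
  unfold length
  calc ∫⁻ s in Icc (0 : ℝ) 1, ENNReal.ofReal
        (rho α β (AffineMap.lineMap w z s) * ‖deriv (AffineMap.lineMap w z : ℝ → ℂ) s‖)
      ≤ ∫⁻ _ in Icc (0 : ℝ) 1, ENNReal.ofReal (B * ‖z - w‖) := by
        refine setLIntegral_mono measurable_const fun s hs => ?_
        rw [AffineMap.hasDerivAt_lineMap.deriv]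
        gcongr
        exact hB _ (by rw [segment_eq_image_lineMap]; exact ⟨s, hs, rfl⟩)
    _ = _ := by simp

/-- Modified Bergman discs near the unit circle contain Euclidean discs of radius comparable to
the distance to the circle. -/
theorem exists_ball_subset_bergmanDisc {α β : ℝ} (hα : -1 < α) (h1 : -1 < β) (hβ : β ≤ 0)
    {r : ℝ} (hr : 0 < r) :
    ∃ ε R : ℝ, 0 < ε ∧ ε ≤ 1 / 2 ∧ R < 1 ∧ ∀ z : ℂ, R ≤ ‖z‖ → ‖z‖ < 1 →
      Metric.ball z (ε * (1 - ‖z‖)) ⊆ bergmanDisc α β z r := by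
  obtain ⟨R, c, C, hR0, hR1, hc, hC, hb⟩ := exists_rho_bounds hα h1 hβ
  -- The bound `1/2` keeps `1-|ζ| ≥ δ/2` on the ball, so `ϱ ≤ 2C/δ` there and segments have length
  -- at most `2Cε ≤ r/2`. The radius `(1+R)/2` keeps the ball in `|ζ| ≥ R`.
  refine ⟨min (1 / 2) (r / (4 * C)), (1 + R) / 2, by positivity, min_le_left _ _, by linarith,
    fun z hz hz1 w hw => ?_⟩
  set ε := min (1 / 2) (r / (4 * C))
  set δ := 1 - ‖z‖ with hδ
  have hδ0 : 0 < δ := by linarith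
  have hball : ∀ ζ ∈ Metric.ball z (ε * δ), R ≤ ‖ζ‖ ∧ ‖ζ‖ < 1 ∧ δ / 2 ≤ 1 - ‖ζ‖ := by
    intro ζ hζ
    have h1 : ‖ζ - z‖ < ε * δ := by simpa [dist_eq_norm] using hζ
    have h2 : ε * δ ≤ 1 / 2 * δ := by gcongr; exact min_le_left _ _
    have h3 := abs_le.1 (abs_norm_sub_norm_le ζ z)
    refine ⟨?_, ?_, ?_⟩ <;> linarith
  have hseg : segment ℝ w z ⊆ Metric.ball z (ε * δ) :=
    (convex_ball z (ε * δ)).segment_subset hw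
      (Metric.mem_ball_self (by positivity))
  refine ⟨⟨hR0.trans_le (hball w hw).1, (hball w hw).2.1⟩, ?_⟩
  refine (dist_le_of_segment (B := C / (δ / 2)) (fun ζ hζ => (hball ζ (hseg hζ)).2.1)
    fun ζ hζ => ?_).trans_lt ?_
  · have := hball ζ (hseg hζ)
    refine (hb ζ this.1 this.2.1).2.trans ?_
    gcongr
    exact this.2.2
  · rw [ENNReal.ofReal_lt_ofReal_iff hr]
    have h2 : ‖z - w‖ ≤ ε * δ := by
      rw [← dist_eq_norm, dist_comm]; exact (Metric.mem_ball.1 hw).le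
    calc C / (δ / 2) * ‖z - w‖ ≤ C / (δ / 2) * (ε * δ) := by gcongr
      _ = 2 * C * ε := by field_simp
      _ ≤ 2 * C * (r / (4 * C)) := by gcongr; exact min_le_right _ _
      _ = r / 2 := by field_simp; ring
      _ < r := by linarith

/-- The fundamental theorem of calculus is summed over the pieces; breakpoints are null, so the
derivative bound is needed only on open intervals. -/
theorem enorm_sub_le_lintegral_of_piecewise {f : ℝ → ℝ} {g : ℝ → ℝ≥0∞} {t : ℕ → ℝ}
    (ht : Monotone t) (n : ℕ) (hf : ∀ i < n, ContDiffOn ℝ 1 f (Icc (t i) (t (i + 1))))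
    (hg : ∀ i < n, ∀ s ∈ Ioo (t i) (t (i + 1)), ‖deriv f s‖ₑ ≤ g s) :
    ‖f (t n) - f (t 0)‖ₑ ≤ ∫⁻ s in Ioc (t 0) (t n), g s := by
  induction n with
  | zero => simp
  | succ n ih =>
    have h1 := ih (fun i hi => hf i (by omega)) (fun i hi => hg i (by omega))
    have h2 : ‖f (t (n + 1)) - f (t n)‖ₑ ≤ ∫⁻ s in Ioc (t n) (t (n + 1)), g s := by
      refine (enorm_sub_le_lintegral_deriv_of_contDiffOn_Icc (hf n (by omega))
        (ht n.le_succ)).trans ?_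
      rw [← restrict_Ioo_eq_restrict_Icc, ← restrict_Ioo_eq_restrict_Ioc]
      exact setLIntegral_mono' measurableSet_Ioo (hg n (by omega))
    rw [← Ioc_union_Ioc_eq_Ioc (ht n.zero_le) (ht n.le_succ),
      lintegral_union measurableSet_Ioc (Ioc_disjoint_Ioc_of_le le_rfl)]
    have e : f (t (n + 1)) - f (t 0) = (f (t n) - f (t 0)) + (f (t (n + 1)) - f (t n)) := by ring
    rw [e]
    exact (enorm_add_le _ _).trans (add_le_add h1 h2)

/-- A smooth substitute for `2 log(δ + |γ - z|)`, whose norm need not be differentiable where `γ =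
z`. -/
theorem hasDerivAt_log_sq_add_norm_sub_sq {γ : ℝ → ℂ} {γ' z : ℂ} {δ s : ℝ} (hδ : 0 < δ)
    (hγ : HasDerivAt γ γ' s) :
    HasDerivAt (fun s => Real.log (δ ^ 2 + ‖γ s - z‖ ^ 2))
      (2 * inner ℝ (γ s - z) γ' / (δ ^ 2 + ‖γ s - z‖ ^ 2)) s := by
  have h := ((hγ.sub_const z).norm_sq).const_add (δ ^ 2)
  exact h.log (by positivity)

theorem abs_two_mul_inner_div_le {x v : ℂ} {δ : ℝ} (hδ : 0 < δ) :
    |2 * inner ℝ x v / (δ ^ 2 + ‖x‖ ^ 2)| ≤ 4 / (δ + ‖x‖) * ‖v‖ := by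
  have hx := norm_nonneg x
  rw [abs_div, abs_of_pos (by positivity : 0 < δ ^ 2 + ‖x‖ ^ 2), abs_mul, abs_two]
  have h := abs_real_inner_le_norm x v
  calc 2 * |inner ℝ x v| / (δ ^ 2 + ‖x‖ ^ 2) ≤ 2 * (‖x‖ * ‖v‖) / (δ ^ 2 + ‖x‖ ^ 2) := by gcongr
    _ = 2 * ‖x‖ / (δ ^ 2 + ‖x‖ ^ 2) * ‖v‖ := by ring
    _ ≤ 4 / (δ + ‖x‖) * ‖v‖ := by
      gcongr ?_ * _
      rw [div_le_div_iff₀ (by positivity) (by positivity)]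
      nlinarith [sq_nonneg (δ - ‖x‖), sq_nonneg δ]

/-- Along the curve `log(δ² + |γ-z|²)` changes at rate at most `(4/c) ϱ |γ'|`, so by less than
`4r/c` in total. Its value at the endpoint `z` is `log δ²`; exponentiating bounds `|γ(s₀) - z|`. -/
theorem norm_sub_lt_of_length_lt {α β c r T s₀ : ℝ} (hc : 0 < c) (hr : 0 < r) {w z : ℂ}
    (hz : ‖z‖ < 1) {γ : ℝ → ℂ} (hγ : IsCurve γ w z) (hl : length α β γ < ENNReal.ofReal r)
    (hrho : ∀ ζ ∈ disc, ‖ζ - z‖ < T → c / (1 - ‖ζ‖) ≤ rho α β ζ)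
    (h0 : 0 ≤ s₀) (h1 : s₀ ≤ 1) (hs : ∀ s ∈ Ioc s₀ 1, ‖γ s - z‖ < T) :
    ‖γ s₀ - z‖ < Real.exp (2 * r / c) * (1 - ‖z‖) := by
  obtain ⟨n, t, htm, ht0, htn, htd⟩ := hγ.piecewise
  set δ := 1 - ‖z‖ with hδ
  have hδ0 : 0 < δ := by linarith
  set f : ℝ → ℝ := fun s => Real.log (δ ^ 2 + ‖γ s - z‖ ^ 2) with hf
  -- The partition is cut off at `s₀`: pieces to the left collapse to a point, the others remain
  -- inside original pieces.
  set t' : ℕ → ℝ := fun i => max s₀ (t i) with ht'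
  have ht'm : Monotone t' := fun i j hij => max_le_max le_rfl (htm hij)
  have ht'0 : t' 0 = s₀ := by simp [ht', ht0, h0]
  have ht'n : t' n = 1 := by simp [ht', htn, h1]
  have hcase : ∀ i, t' i < t' (i + 1) → Icc (t' i) (t' (i + 1)) ⊆ Icc (t i) (t (i + 1)) := by
    intro i hi
    have hlt : s₀ < t (i + 1) := by
      by_contra hcon
      push Not at hcon
      have e : t' (i + 1) = s₀ := max_eq_left hcon
      rw [e] at hi
      exact absurd (le_max_left s₀ (t i)) (not_le.2 hi)
    rw [show t' (i + 1) = t (i + 1) from max_eq_right hlt.le]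
    exact Icc_subset_Icc_left (le_max_right _ _)
  have hle1 : ∀ i ≤ n, t' i ≤ 1 := fun i hi => ht'n ▸ ht'm hi
  have key : ‖f (t' n) - f (t' 0)‖ₑ ≤ ∫⁻ s in Ioc (t' 0) (t' n),
      ENNReal.ofReal (4 / c) * ENNReal.ofReal (rho α β (γ s) * ‖deriv γ s‖) := by
    refine enorm_sub_le_lintegral_of_piecewise ht'm n (fun i hi => ?_) fun i hi s hsi => ?_
    · rcases (ht'm i.le_succ).eq_or_lt with h | h
      · rw [Nat.succ_eq_add_one] at h
        rw [← h, Icc_self]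
        exact (contDiffOn_const (c := f (t' i))).congr fun s hs => by rw [hs]
      · have h2 := (htd i hi).mono (hcase i h)
        have h3 : ContDiffOn ℝ 1 (fun s => δ ^ 2 + ‖γ s - z‖ ^ 2) (Icc (t' i) (t' (i + 1))) :=
          contDiffOn_const.add ((h2.sub contDiffOn_const).norm_sq ℝ)
        exact h3.log fun s _ => by positivity
    · have h := hsi.1.trans hsi.2
      have hd : DifferentiableAt ℝ γ s :=
        (((htd i hi).mono (hcase i h)).contDiffAt (Icc_mem_nhds hsi.1 hsi.2)).differentiableAt
          one_ne_zero
      have hs0 : s₀ < s := (le_max_left _ _).trans_lt hsi.1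
      have hs1 : s ≤ 1 := hsi.2.le.trans (hle1 _ hi)
      have hm := hγ.mem_disc s ⟨h0.trans hs0.le, hs1⟩
      have hm' : ‖γ s‖ < 1 := hm
      rw [(hasDerivAt_log_sq_add_norm_sub_sq hδ0 hd.hasDerivAt).deriv, ← ofReal_norm,
        ← ENNReal.ofReal_mul (by positivity)]
      apply ENNReal.ofReal_le_ofReal
      refine (abs_two_mul_inner_div_le hδ0).trans ?_
      rw [← mul_assoc]
      gcongr
      have h4 := hrho _ hm (hs s ⟨hs0, hs1⟩)
      have h5 : 1 - ‖γ s‖ ≤ δ + ‖γ s - z‖ := by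
        have := norm_sub_norm_le z (γ s)
        rw [norm_sub_rev] at this
        linarith
      calc 4 / (δ + ‖γ s - z‖) ≤ 4 / (1 - ‖γ s‖) := by gcongr
        _ = 4 / c * (c / (1 - ‖γ s‖)) := by field_simp
        _ ≤ _ := by gcongr
  have hlen : (∫⁻ s in Ioc (t' 0) (t' n),
      ENNReal.ofReal (4 / c) * ENNReal.ofReal (rho α β (γ s) * ‖deriv γ s‖))
        < ENNReal.ofReal (4 / c * r) := by
    rw [lintegral_const_mul' _ _ ENNReal.ofReal_ne_top, ENNReal.ofReal_mul (by positivity)]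
    have : (∫⁻ s in Ioc (t' 0) (t' n), ENNReal.ofReal (rho α β (γ s) * ‖deriv γ s‖))
        ≤ length α β γ := by
      refine lintegral_mono_set ?_
      rw [ht'0, ht'n]
      exact Ioc_subset_Icc_self.trans (Icc_subset_Icc_left h0)
    have hpos : ENNReal.ofReal (4 / c) ≠ 0 := by
      simpa using (by positivity : 0 < 4 / c)
    exact (ENNReal.mul_lt_mul_iff_right hpos ENNReal.ofReal_ne_top).2 (this.trans_lt hl)
  have hfin := key.trans_lt hlen
  rw [ht'0, ht'n, ← ofReal_norm, ENNReal.ofReal_lt_ofReal_iff (by positivity)] at hfin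
  have hfin2 := (abs_lt.1 hfin).1
  simp only [hf, hγ.target, sub_self, norm_zero] at hfin2
  set x := ‖γ s₀ - z‖
  have hlog : Real.log (δ ^ 2 + x ^ 2) < Real.log (δ ^ 2) + 4 / c * r := by
    norm_num at hfin2 ⊢
    linarith
  have hexp := Real.exp_lt_exp.2 hlog
  rw [Real.exp_add, Real.exp_log (by positivity), Real.exp_log (by positivity)] at hexp
  have e : Real.exp (4 / c * r) = Real.exp (2 * r / c) ^ 2 := by
    rw [← Real.exp_nat_mul]; congr 1; push_cast; ring
  rw [e] at hexp
  refine lt_of_pow_lt_pow_left₀ 2 (by positivity) ?_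
  nlinarith [sq_nonneg δ]

/-- Modified Bergman discs near the unit circle are contained in Euclidean discs of radius
comparable to the distance to the circle. -/
theorem exists_bergmanDisc_subset_ball {α β : ℝ} (hα : -1 < α) (h1 : -1 < β) (hβ : β ≤ 0)
    {r : ℝ} (hr : 0 < r) :
    ∃ M R : ℝ, 0 < M ∧ R < 1 ∧ ∀ z : ℂ, R ≤ ‖z‖ → ‖z‖ < 1 →
      bergmanDisc α β z r ⊆ Metric.ball z (M * (1 - ‖z‖)) := by
  obtain ⟨R, c, C, hR0, hR1, hc, hC, hb⟩ := exists_rho_bounds hα h1 hβ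
  set M := Real.exp (2 * r / c) with hM
  have hM0 : 0 < M := Real.exp_pos _
  -- The threshold is exactly the condition `M(1-|z|) ≤ |z| - R`: the target ball lies where the
  -- bounds on `ϱ` hold.
  refine ⟨M, (M + R) / (M + 1), hM0, by rw [div_lt_one (by positivity)]; linarith,
    fun z hz hz1 w hw => ?_⟩
  have hT : M * (1 - ‖z‖) ≤ ‖z‖ - R := by
    rw [div_le_iff₀ (by positivity)] at hz
    linarith
  obtain ⟨γ, hγ, hl⟩ := (by simpa [dist, iInf_lt_iff] using hw.2 :
    ∃ γ, ∃ _ : IsCurve γ w z, length α β γ < ENNReal.ofReal r)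
  have hrho : ∀ ζ ∈ disc, ‖ζ - z‖ < ‖z‖ - R → c / (1 - ‖ζ‖) ≤ rho α β ζ := by
    intro ζ hζ hζz
    have := norm_sub_norm_le z ζ
    rw [norm_sub_rev] at this
    exact (hb ζ (by linarith) hζ).1
  have hlt : ∀ s₀ : ℝ, 0 ≤ s₀ → s₀ ≤ 1 → (∀ s ∈ Ioc s₀ 1, ‖γ s - z‖ < ‖z‖ - R) →
      ‖γ s₀ - z‖ < M * (1 - ‖z‖) := fun s₀ h0 h1 hs =>
    norm_sub_lt_of_length_lt hc hr hz1 hγ hl hrho h0 h1 hs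
  -- A curve that leaves the region has a last time `s₀` outside it. The estimate on `(s₀, 1]` puts
  -- `γ(s₀)` strictly inside, a contradiction.
  set S := {s ∈ Icc (0 : ℝ) 1 | ‖z‖ - R ≤ ‖γ s - z‖} with hS
  have hSc : IsCompact S := by
    have hcl : IsClosed S := by
      have := (hγ.continuousOn.sub continuousOn_const).norm.preimage_isClosed_of_isClosed
        isClosed_Icc (isClosed_Ici (a := ‖z‖ - R)) (f := fun s => ‖γ s - z‖)
      exact this
    exact isCompact_Icc.of_isClosed_subset hcl fun s hs => hs.1
  have hSe : S = ∅ := by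
    by_contra hne
    obtain ⟨s₀, hs₀, hmax⟩ := hSc.exists_isGreatest (nonempty_iff_ne_empty.2 hne)
    have := hlt s₀ hs₀.1.1 hs₀.1.2 fun s hs => by
      by_contra hcon
      exact absurd (hmax ⟨⟨hs₀.1.1.trans hs.1.le, hs.2⟩, not_lt.1 hcon⟩) (not_le.2 hs.1)
    linarith [hs₀.2]
  have := hlt 0 le_rfl zero_le_one fun s hs => by
    by_contra hcon
    have : s ∈ S := ⟨⟨hs.1.le, hs.2⟩, not_lt.1 hcon⟩
    rw [hSe] at this
    exact this
  rw [hγ.source] at this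
  rwa [Metric.mem_ball, dist_eq_norm]

/-! ### The Forelli-Rudin estimate. -/

/-- A nonnegative derivative of a continuous function is integrable, so endpoint singularities such
as those of `ρ^(2β+1)` and `(1-ρ)^α` are allowed. -/
theorem lintegral_Ioo_ofReal_of_hasDerivAt {G g : ℝ → ℝ} {a b : ℝ} (hab : a ≤ b)
    (hG : ContinuousOn G (Icc a b)) (hd : ∀ x ∈ Ioo a b, HasDerivAt G (g x) x)
    (hg : ∀ x ∈ Ioo a b, 0 ≤ g x) :
    ∫⁻ x in Ioo a b, ENNReal.ofReal (g x) = ENNReal.ofReal (G b - G a) := by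
  have hi : IntegrableOn g (Ioc a b) := intervalIntegral.integrableOn_deriv_of_nonneg hG hd hg
  have hi' : IntegrableOn g (Ioo a b) := hi.mono_set Ioo_subset_Ioc_self
  rw [← ofReal_integral_eq_lintegral_ofReal hi'
    ((ae_restrict_iff' measurableSet_Ioo).2 (Eventually.of_forall hg)),
    ← integral_Ioc_eq_integral_Ioo, ← intervalIntegral.integral_of_le hab,
    intervalIntegral.integral_eq_sub_of_hasDerivAt_of_le hab hG hd
      ((intervalIntegrable_iff_integrableOn_Ioc_of_le hab).2 hi)]

theorem norm_one_sub_mul_circleMap (a : ℂ) (θ : ℝ) :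
    ‖1 - a * circleMap 0 1 θ‖ = ‖circleMap 0 1 θ - star a‖ := by
  have h : ‖star (circleMap 0 1 θ)‖ = 1 := by simp
  have e : star (circleMap 0 1 θ) * circleMap 0 1 θ = 1 := by
    rw [mul_comm, Complex.star_def, Complex.mul_conj, Complex.normSq_eq_norm_sq]
    simp
  calc ‖1 - a * circleMap 0 1 θ‖ = ‖star (1 - a * circleMap 0 1 θ)‖ := (norm_star _).symm
    _ = ‖star (circleMap 0 1 θ) * (circleMap 0 1 θ - star a)‖ := by
      rw [mul_sub, e, star_sub, star_mul, star_one]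
    _ = _ := by rw [norm_mul, h, one_mul]

theorem one_sub_norm_le (a : ℂ) (θ : ℝ) : 1 - ‖a‖ ≤ ‖1 - a * circleMap 0 1 θ‖ := by
  have := norm_sub_norm_le 1 (a * circleMap 0 1 θ)
  simpa using this

theorem lintegral_inv_norm_sq {a : ℂ} (ha : ‖a‖ < 1) :
    ∫⁻ θ in Ioo (-Real.pi) Real.pi, ENNReal.ofReal (1 / ‖1 - a * circleMap 0 1 θ‖ ^ 2)
      = ENNReal.ofReal (2 * Real.pi / (1 - ‖a‖ ^ 2)) := by
  have hpi := Real.pi_pos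
  have hpos : ∀ θ : ℝ, 0 < ‖1 - a * circleMap 0 1 θ‖ := fun θ =>
    (sub_pos.2 ha).trans_le (one_sub_norm_le a θ)
  have hcont : Continuous fun θ : ℝ => 1 / ‖1 - a * circleMap 0 1 θ‖ ^ 2 := by
    have : Continuous fun θ : ℝ => ‖1 - a * circleMap 0 1 θ‖ ^ 2 := by fun_prop
    exact continuous_const.div this fun θ => (pow_pos (hpos θ) 2).ne'
  have h1 : 0 < 1 - ‖a‖ ^ 2 := by nlinarith [norm_nonneg a]
  -- The integrand is the Poisson kernel at `ā` divided by `1-|a|²`; the Poisson formula is applied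
  -- to the constant `1`.
  have hP := (diffContOnCl_const (s := Metric.ball (0 : ℂ) 1) (c := (1 : ℝ) •
    (1 : ℂ))).circleAverage_poissonKernel_smul' (w := star a) (by simpa using ha)
  have hint : ∫ θ in (-Real.pi)..Real.pi, 1 / ‖1 - a * circleMap 0 1 θ‖ ^ 2
      = 2 * Real.pi / (1 - ‖a‖ ^ 2) := by
    have hper : Function.Periodic (fun θ : ℝ => 1 / ‖1 - a * circleMap 0 1 θ‖ ^ 2)
        (2 * Real.pi) := fun θ => by simp only [periodic_circleMap 0 1 θ]
    have h2 := hper.intervalIntegral_add_eq (-Real.pi) 0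
    rw [show -Real.pi + 2 * Real.pi = Real.pi by ring, zero_add] at h2
    rw [h2]
    rw [Real.circleAverage_def] at hP
    have e : ∀ θ : ℝ, ((‖circleMap 0 1 θ - 0‖ ^ 2 - ‖star a - 0‖ ^ 2)
        / ‖circleMap 0 1 θ - 0 - (star a - 0)‖ ^ 2) • ((1 : ℝ) • (1 : ℂ))
        = (((1 - ‖a‖ ^ 2) * (1 / ‖1 - a * circleMap 0 1 θ‖ ^ 2) : ℝ) : ℂ) := fun θ => by
      rw [norm_one_sub_mul_circleMap]
      simp
      ring
    simp_rw [e] at hP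
    rw [intervalIntegral.integral_ofReal, intervalIntegral.integral_const_mul] at hP
    simp only [one_smul, Complex.real_smul] at hP
    have hP' : (2 * Real.pi)⁻¹ * ((1 - ‖a‖ ^ 2) *
        ∫ θ in (0 : ℝ)..2 * Real.pi, 1 / ‖1 - a * circleMap 0 1 θ‖ ^ 2) = 1 := by
      exact_mod_cast hP
    field_simp at hP' ⊢
    linarith
  have hi := (hcont.integrableOn_Icc (a := -Real.pi) (b := Real.pi) (μ := volume)).mono_set
    Ioo_subset_Icc_self
  rw [← ofReal_integral_eq_lintegral_ofReal hi (Eventually.of_forall fun θ => by positivity),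
    ← integral_Ioc_eq_integral_Ioo, ← intervalIntegral.integral_of_le (by linarith), hint]

/-- The exponent `α + 3` exceeds `2`, so the excess `α + 1` is bounded by `|1 - aζ| ≥ 1-|a|` and the
exact quadratic integral remains. -/
theorem lintegral_rpow_norm_le {α : ℝ} (hα : -1 < α) {a : ℂ} (ha : ‖a‖ < 1) :
    ∫⁻ θ in Ioo (-Real.pi) Real.pi,
        ENNReal.ofReal (‖1 - a * circleMap 0 1 θ‖ ^ (-(α + 3)))
      ≤ ENNReal.ofReal (2 * Real.pi * (1 - ‖a‖) ^ (-(α + 2))) := by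
  have hpi := Real.pi_pos
  have h0 : 0 < 1 - ‖a‖ := sub_pos.2 ha
  calc _ ≤ ∫⁻ θ in Ioo (-Real.pi) Real.pi, ENNReal.ofReal ((1 - ‖a‖) ^ (-(α + 1))) *
        ENNReal.ofReal (1 / ‖1 - a * circleMap 0 1 θ‖ ^ 2) := by
        refine lintegral_mono fun θ => ?_
        rw [← ENNReal.ofReal_mul (by positivity)]
        apply ENNReal.ofReal_le_ofReal
        have hx := one_sub_norm_le a θ
        set x := ‖1 - a * circleMap 0 1 θ‖
        have hx0 : 0 < x := h0.trans_le hx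
        have : x ^ (-(α + 3)) = x ^ (-(α + 1)) * (1 / x ^ 2) := by
          rw [one_div, ← Real.rpow_natCast, ← Real.rpow_neg hx0.le, ← Real.rpow_add hx0]
          congr 1
          push_cast
          ring
        rw [this]
        gcongr ?_ * _
        exact Real.rpow_le_rpow_of_nonpos h0 hx (by linarith)
    _ = ENNReal.ofReal ((1 - ‖a‖) ^ (-(α + 1)) * (2 * Real.pi / (1 - ‖a‖ ^ 2))) := by
        rw [lintegral_const_mul' _ _ ENNReal.ofReal_ne_top, lintegral_inv_norm_sq ha,
          ENNReal.ofReal_mul (by positivity)]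
    _ ≤ _ := by
        apply ENNReal.ofReal_le_ofReal
        have : (1 - ‖a‖) ^ (-(α + 2)) = (1 - ‖a‖) ^ (-(α + 1)) / (1 - ‖a‖) := by
          rw [← Real.rpow_sub_one h0.ne']; ring_nf
        rw [this]
        have h1 : 1 - ‖a‖ ≤ 1 - ‖a‖ ^ 2 := by nlinarith [norm_nonneg a]
        calc (1 - ‖a‖) ^ (-(α + 1)) * (2 * Real.pi / (1 - ‖a‖ ^ 2))
            ≤ (1 - ‖a‖) ^ (-(α + 1)) * (2 * Real.pi / (1 - ‖a‖)) := by gcongr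
          _ = _ := by ring

theorem lintegral_rpow_Ioo {β : ℝ} (hβ : -1 < β) :
    ∫⁻ ρ in Ioo (0 : ℝ) 1, ENNReal.ofReal (ρ ^ (2 * β + 1)) = ENNReal.ofReal (1 / (2 * β + 2)) := by
  have h := lintegral_Ioo_ofReal_of_hasDerivAt (a := 0) (b := 1)
    (G := fun ρ : ℝ => ρ ^ (2 * β + 2) / (2 * β + 2)) (g := fun ρ => ρ ^ (2 * β + 1)) zero_le_one
    ((continuousOn_id.rpow_const fun x _ => Or.inr (by linarith)).div_const _)
    (fun x hx => ?_) (fun x hx => Real.rpow_nonneg hx.1.le _)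
  · rw [h, Real.zero_rpow (by linarith), Real.one_rpow]
    simp
  · have h2 := (Real.hasDerivAt_rpow_const (x := x) (p := 2 * β + 2) (Or.inl hx.1.ne')).div_const
      (2 * β + 2)
    refine h2.congr_deriv ?_
    have : 2 * β + 2 ≠ 0 := by linarith
    rw [show 2 * β + 2 - 1 = 2 * β + 1 by ring]
    exact mul_div_cancel_left₀ _ this

theorem lintegral_one_sub_rpow_mul_le {α δ : ℝ} (hα : -1 < α) (hδ : 0 < δ) :
    ∫⁻ ρ in Ioo (0 : ℝ) 1, ENNReal.ofReal ((1 - ρ) ^ α * (1 - ρ + δ) ^ (-(α + 2)))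
      ≤ ENNReal.ofReal (1 / ((α + 1) * δ)) := by
  have hα1 : 0 < α + 1 := by linarith
  -- The quotient `x/(x+δ)` has derivative `δ/(x+δ)²` in `x = 1-ρ`, which gives this explicit
  -- primitive.
  have h := lintegral_Ioo_ofReal_of_hasDerivAt (a := 0) (b := 1)
    (G := fun ρ : ℝ => -(((1 - ρ) / (1 - ρ + δ)) ^ (α + 1) / ((α + 1) * δ)))
    (g := fun ρ => (1 - ρ) ^ α * (1 - ρ + δ) ^ (-(α + 2))) zero_le_one
    ?_ (fun x hx => ?_) (fun x hx => ?_)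
  · rw [h]
    apply ENNReal.ofReal_le_ofReal
    simp only [sub_self, zero_div, Real.zero_rpow hα1.ne', neg_zero, zero_add, sub_zero]
    rw [zero_sub, neg_neg]
    gcongr
    refine Real.rpow_le_one (by positivity) ?_ hα1.le
    rw [div_le_one (by positivity)]
    linarith
  · refine ContinuousOn.neg (ContinuousOn.div_const (ContinuousOn.rpow_const ?_ ?_) _)
    · refine ContinuousOn.div (by fun_prop) (by fun_prop) fun x hx => ?_
      linarith [hx.2]
    · exact fun x _ => Or.inr hα1.le
  · have hx1 : 0 < 1 - x := by linarith [hx.2]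
    have hx2 : 0 < 1 - x + δ := by linarith
    have h1 := (hasDerivAt_id x).const_sub 1
    have h2 := h1.div (h1.add_const δ) hx2.ne'
    have h3 := ((h2.rpow_const (p := α + 1) (Or.inl (by simp only [Pi.div_apply, id]; positivity))).div_const
      ((α + 1) * δ)).neg
    refine h3.congr_deriv ?_
    simp only [Pi.div_apply, id]
    rw [show α + 1 - 1 = α by ring, Real.div_rpow hx1.le hx2.le, Real.rpow_neg hx2.le,
      show α + 2 = α + (2 : ℕ) by norm_num, Real.rpow_add_natCast hx2.ne']
    field_simp
    ring
  · have hx1 : 0 < 1 - x := by linarith [hx.2]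
    have hx2 : 0 < 1 - x + δ := by linarith
    positivity

/-- The singularities at `0` and at the circle are separated by splitting at `ρ = 1/2`: each half is
bounded by one summand. -/
theorem radial_weight_le {α β : ℝ} (hα : -1 < α) (hβ : -1 < β) {ρ s : ℝ} (h0 : 0 < ρ)
    (h1 : ρ < 1) (hs0 : 0 ≤ s) (hs1 : s < 1) :
    ρ ^ (2 * β + 1) * (1 - ρ ^ 2) ^ α * (1 - s * ρ) ^ (-(α + 2))
      ≤ 2 ^ |α| * 2 ^ |α| * 2 ^ (α + 2) * ρ ^ (2 * β + 1)
        + 2 * 2 ^ |α| * 2 ^ (α + 2) * ((1 - ρ) ^ α * (1 - ρ + (1 - s)) ^ (-(α + 2))) := by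
  have hx : 0 < 1 - ρ := by linarith
  have hA : (1 - ρ ^ 2) ^ α ≤ (1 - ρ) ^ α * 2 ^ |α| := by
    rw [show 1 - ρ ^ 2 = (1 - ρ) * (1 + ρ) by ring, Real.mul_rpow hx.le (by linarith)]
    gcongr
    calc (1 + ρ) ^ α ≤ (1 + ρ) ^ |α| :=
          Real.rpow_le_rpow_of_exponent_le (by linarith) (le_abs_self α)
      _ ≤ 2 ^ |α| := Real.rpow_le_rpow (by linarith) (by linarith) (abs_nonneg α)
  have hhalf : ∀ y : ℝ, 0 < y → (y / 2) ^ (-(α + 2)) = 2 ^ (α + 2) * y ^ (-(α + 2)) := fun y hy => by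
    rw [Real.div_rpow hy.le (by norm_num), Real.rpow_neg (show (0 : ℝ) ≤ 2 by norm_num)]
    field_simp
  have hsρ : s * ρ < 1 := by nlinarith
  have hpρ := Real.rpow_pos_of_pos h0 (2 * β + 1)
  have hp1 : 0 < 1 - ρ ^ 2 := by nlinarith
  have hp3 : 0 < 1 - ρ + (1 - s) := by linarith
  have hp2 : 0 < 1 - s * ρ := by linarith
  rcases lt_or_ge ρ (1 / 2) with hρ | hρ
  · have hB : (1 - ρ) ^ α ≤ 2 ^ |α| := by
      calc (1 - ρ) ^ α ≤ (1 - ρ) ^ (-|α|) :=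
            Real.rpow_le_rpow_of_exponent_ge hx (by linarith) (neg_abs_le α)
        _ ≤ (1 / 2 : ℝ) ^ (-|α|) :=
            Real.rpow_le_rpow_of_nonpos (by norm_num) (by linarith) (by simp)
        _ = 2 ^ |α| := by
            rw [one_div, Real.inv_rpow (by norm_num), Real.rpow_neg (by norm_num), inv_inv]
    have hC : (1 - s * ρ) ^ (-(α + 2)) ≤ 2 ^ (α + 2) := by
      calc (1 - s * ρ) ^ (-(α + 2)) ≤ (1 / 2 : ℝ) ^ (-(α + 2)) :=
            Real.rpow_le_rpow_of_nonpos (by norm_num) (by nlinarith) (by linarith)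
        _ = _ := by rw [hhalf 1 one_pos, Real.one_rpow, mul_one]
    calc ρ ^ (2 * β + 1) * (1 - ρ ^ 2) ^ α * (1 - s * ρ) ^ (-(α + 2))
        ≤ ρ ^ (2 * β + 1) * (2 ^ |α| * 2 ^ |α|) * 2 ^ (α + 2) := by
          gcongr
          exact hA.trans (by gcongr)
      _ = 2 ^ |α| * 2 ^ |α| * 2 ^ (α + 2) * ρ ^ (2 * β + 1) := by ring
      _ ≤ _ := le_add_of_nonneg_right (by positivity)
  · have hB : ρ ^ (2 * β + 1) ≤ 2 := by
      calc ρ ^ (2 * β + 1) ≤ ρ ^ (-1 : ℝ) :=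
            Real.rpow_le_rpow_of_exponent_ge h0 h1.le (by linarith)
        _ = ρ⁻¹ := Real.rpow_neg_one ρ
        _ ≤ 2 := by rw [inv_le_comm₀ h0 (by norm_num)]; linarith
    have hC : (1 - s * ρ) ^ (-(α + 2)) ≤ 2 ^ (α + 2) * (1 - ρ + (1 - s)) ^ (-(α + 2)) := by
      rw [← hhalf _ hp3]
      refine Real.rpow_le_rpow_of_nonpos (by positivity) ?_ (by linarith)
      -- `2(1 - sρ) - (1-ρ) - (1-s) = ρ(1-s) + s(1-ρ) ≥ 0`.
      nlinarith
    calc ρ ^ (2 * β + 1) * (1 - ρ ^ 2) ^ α * (1 - s * ρ) ^ (-(α + 2))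
        ≤ 2 * ((1 - ρ) ^ α * 2 ^ |α|) * (2 ^ (α + 2) * (1 - ρ + (1 - s)) ^ (-(α + 2))) := by
          gcongr
      _ = 2 * 2 ^ |α| * 2 ^ (α + 2) * ((1 - ρ) ^ α * (1 - ρ + (1 - s)) ^ (-(α + 2))) := by ring
      _ ≤ _ := le_add_of_nonneg_left (by positivity)

theorem measurable_density (α β : ℝ) : Measurable (density α β) := by
  unfold density
  fun_prop

theorem isOpen_disc : IsOpen disc := isOpen_lt continuous_norm continuous_const

theorem lintegral_mu (α β : ℝ) {g : ℂ → ℝ≥0∞} (hg : Measurable g) :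
    ∫⁻ w, g w ∂(mu α β) = ∫⁻ w in disc, ENNReal.ofReal (density α β w) * g w := by
  unfold mu
  rw [lintegral_withDensity_eq_lintegral_mul _ (measurable_density α β).ennreal_ofReal hg]
  rfl

theorem polarCoord_symm_eq_circleMap (p : ℝ × ℝ) :
    Complex.polarCoord.symm p = p.1 * circleMap 0 1 p.2 := by
  rw [Complex.polarCoord_symm_apply, circleMap_zero, Complex.exp_mul_I]
  simp

/-- Forelli-Rudin estimate for `μ_{α,β}`. -/
theorem exists_lintegral_rpow_le {α β : ℝ} (hα : -1 < α) (hβ : -1 < β) :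
    ∃ C > 0, ∀ z : ℂ, ‖z‖ < 1 →
      ∫⁻ w, ENNReal.ofReal (‖1 - star z * w‖ ^ (-(α + 3))) ∂(mu α β)
        ≤ ENNReal.ofReal (C / (1 - ‖z‖)) := by
  have hpi := Real.pi_pos
  have hB := ProbabilityTheory.beta_pos (show 0 < α + 1 by linarith) (show 0 < β + 1 by linarith)
  set B := ProbabilityTheory.beta (α + 1) (β + 1)
  set A₁ : ℝ := 2 ^ |α| * 2 ^ |α| * 2 ^ (α + 2) with hA₁
  set A₂ : ℝ := 2 * 2 ^ |α| * 2 ^ (α + 2) with hA₂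
  have hA₁0 : 0 < A₁ := by positivity
  have hA₂0 : 0 < A₂ := by positivity
  have hα1 : 0 < α + 1 := by linarith
  have hβ1 : 0 < 2 * β + 2 := by linarith
  refine ⟨2 / B * (A₁ * (1 / (2 * β + 2)) + A₂ * (1 / (α + 1))), by positivity, fun z hz => ?_⟩
  have hδ : 0 < 1 - ‖z‖ := by linarith
  have hδ1 : 1 ≤ 1 / (1 - ‖z‖) := by
    rw [le_div_iff₀ hδ]; linarith [norm_nonneg z]
  have hgm : Measurable fun w : ℂ => ENNReal.ofReal (‖1 - star z * w‖ ^ (-(α + 3))) := by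
    fun_prop
  rw [lintegral_mu α β hgm]
  set F : ℂ → ℝ≥0∞ := fun w => ENNReal.ofReal (density α β w) *
    ENNReal.ofReal (‖1 - star z * w‖ ^ (-(α + 3))) with hF
  have hFm : Measurable F := (measurable_density α β).ennreal_ofReal.mul hgm
  have hFi : Measurable (disc.indicator F) := hFm.indicator isOpen_disc.measurableSet
  rw [← lintegral_indicator isOpen_disc.measurableSet,
    ← Complex.lintegral_comp_polarCoord_symm (disc.indicator F)]
  have hsm : Measurable fun p : ℝ × ℝ => (p.1 : ℂ) * circleMap 0 1 p.2 := by
    have : Continuous fun p : ℝ × ℝ => (p.1 : ℂ) * circleMap 0 1 p.2 := by fun_prop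
    exact this.measurable
  simp_rw [polarCoord_symm_eq_circleMap, smul_eq_mul]
  have hHm : Measurable fun p : ℝ × ℝ =>
      ENNReal.ofReal p.1 * disc.indicator F ((p.1 : ℂ) * circleMap 0 1 p.2) :=
    measurable_fst.ennreal_ofReal.mul (hFi.comp hsm)
  rw [show polarCoord.target = Ioi (0 : ℝ) ×ˢ Ioo (-Real.pi) Real.pi from rfl,
    Measure.volume_eq_prod, ← Measure.prod_restrict, lintegral_prod _ hHm.aemeasurable]
  set K : ℝ → ℝ := fun ρ => 2 / B *
    (ρ ^ (2 * β + 1) * (1 - ρ ^ 2) ^ α * (1 - ‖z‖ * ρ) ^ (-(α + 2))) with hK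
  have hang : ∀ ρ ∈ Ioi (0 : ℝ), ∫⁻ θ in Ioo (-Real.pi) Real.pi,
      ENNReal.ofReal ρ * disc.indicator F ((ρ : ℂ) * circleMap 0 1 θ)
        ≤ (Iio 1).indicator (fun ρ => ENNReal.ofReal (K ρ)) ρ := by
    intro ρ hρ
    have hρ0 : 0 < ρ := hρ
    have hn : ∀ θ, ‖(ρ : ℂ) * circleMap 0 1 θ‖ = ρ := fun θ => by simp [abs_of_pos hρ0]
    by_cases hρ1 : ρ < 1
    · rw [indicator_of_mem (show ρ ∈ Iio 1 from hρ1)]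
      have ha : ‖star z * (ρ : ℂ)‖ = ‖z‖ * ρ := by simp [abs_of_pos hρ0]
      have hc : 0 < 1 - ρ ^ 2 := by nlinarith
      set D := ρ * (ρ ^ (2 * β) * (1 - ρ ^ 2) ^ α / (Real.pi * B)) with hD
      have hD0 : 0 ≤ D := by positivity
      have e : ∀ θ, ENNReal.ofReal ρ * disc.indicator F ((ρ : ℂ) * circleMap 0 1 θ)
          = ENNReal.ofReal D *
            ENNReal.ofReal (‖1 - (star z * (ρ : ℂ)) * circleMap 0 1 θ‖ ^ (-(α + 3))) := fun θ => by
        rw [indicator_of_mem (show (ρ : ℂ) * circleMap 0 1 θ ∈ disc by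
          rw [disc, mem_ofPred_eq, hn]; exact hρ1)]
        simp only [hF, density]
        rw [hn, ← mul_assoc, ← ENNReal.ofReal_mul hρ0.le, mul_assoc (star z)]
      simp_rw [e]
      rw [lintegral_const_mul' _ _ ENNReal.ofReal_ne_top]
      refine (mul_le_mul_right (lintegral_rpow_norm_le hα (by rw [ha]; nlinarith)) _).trans ?_
      rw [← ENNReal.ofReal_mul hD0, ha]
      apply ENNReal.ofReal_le_ofReal
      apply le_of_eq
      have : ρ ^ (2 * β + 1) = ρ ^ (2 * β) * ρ := Real.rpow_add_one hρ0.ne' _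
      simp only [hK, hD, this]
      field_simp
    · rw [indicator_of_notMem (show ρ ∉ Iio 1 from hρ1)]
      refine le_of_eq ?_
      have e : ∀ θ, ENNReal.ofReal ρ * disc.indicator F ((ρ : ℂ) * circleMap 0 1 θ) = 0 := fun θ => by
        rw [indicator_of_notMem (show (ρ : ℂ) * circleMap 0 1 θ ∉ disc by
          rw [disc, mem_ofPred_eq, hn]; exact hρ1), mul_zero]
      simp [e]
  refine (setLIntegral_mono' measurableSet_Ioi hang).trans ?_
  rw [setLIntegral_indicator measurableSet_Iio, inter_comm, Ioi_inter_Iio]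
  calc ∫⁻ ρ in Ioo (0 : ℝ) 1, ENNReal.ofReal (K ρ)
      ≤ ∫⁻ ρ in Ioo (0 : ℝ) 1, (ENNReal.ofReal (2 / B * A₁) * ENNReal.ofReal (ρ ^ (2 * β + 1))
          + ENNReal.ofReal (2 / B * A₂) *
            ENNReal.ofReal ((1 - ρ) ^ α * (1 - ρ + (1 - ‖z‖)) ^ (-(α + 2)))) := by
        refine setLIntegral_mono' measurableSet_Ioo fun ρ hρ => ?_
        have h1 : 0 < 1 - ρ := by linarith [hρ.2]
        have h2 : 0 < 1 - ρ + (1 - ‖z‖) := by linarith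
        have h3 := hρ.1
        rw [← ENNReal.ofReal_mul (by positivity), ← ENNReal.ofReal_mul (by positivity),
          ← ENNReal.ofReal_add (by positivity) (by positivity)]
        apply ENNReal.ofReal_le_ofReal
        have := radial_weight_le hα hβ hρ.1 hρ.2 (norm_nonneg z) hz
        calc K ρ ≤ 2 / B * _ := mul_le_mul_of_nonneg_left this (by positivity)
          _ = _ := by ring
    _ ≤ ENNReal.ofReal (2 / B * A₁) * ENNReal.ofReal (1 / (2 * β + 2))
          + ENNReal.ofReal (2 / B * A₂) * ENNReal.ofReal (1 / ((α + 1) * (1 - ‖z‖))) := by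
        rw [lintegral_add_left (by fun_prop), lintegral_const_mul' _ _ ENNReal.ofReal_ne_top,
          lintegral_const_mul' _ _ ENNReal.ofReal_ne_top, lintegral_rpow_Ioo hβ]
        gcongr
        exact lintegral_one_sub_rpow_mul_le hα hδ
    _ ≤ _ := by
        rw [← ENNReal.ofReal_mul (by positivity), ← ENNReal.ofReal_mul (by positivity),
          ← ENNReal.ofReal_add (by positivity) (by positivity)]
        apply ENNReal.ofReal_le_ofReal
        calc 2 / B * A₁ * (1 / (2 * β + 2)) + 2 / B * A₂ * (1 / ((α + 1) * (1 - ‖z‖)))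
            ≤ 2 / B * A₁ * (1 / (2 * β + 2)) * (1 / (1 - ‖z‖))
              + 2 / B * A₂ * (1 / ((α + 1) * (1 - ‖z‖))) := by
              gcongr ?_ + _
              exact le_mul_of_one_le_right (by positivity) hδ1
          _ = _ := by field_simp

theorem isFiniteMeasure_mu {α β : ℝ} (hα : -1 < α) (hβ : -1 < β) :
    IsFiniteMeasure (mu α β) := by
  obtain ⟨C, -, hC⟩ := exists_lintegral_rpow_le hα hβ
  -- At `z = 0` the integrand is `1`.
  have h := hC 0 (by simp)
  simp only [star_zero, zero_mul, sub_zero, norm_one, Real.one_rpow, ENNReal.ofReal_one,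
    lintegral_one] at h
  exact ⟨h.trans_lt ENNReal.ofReal_lt_top⟩

/-! ### The measure of small Euclidean discs. -/

/-- Euclidean discs of radius `ε (1 - |z|)` have `μ_{α,β}` measure at least of the order of
`(1 - |z|)^{α+2}`. -/
theorem exists_le_mu_ball {α β ε : ℝ} (hα : -1 < α) (h1 : -1 < β) (hβ : β ≤ 0) (hε : 0 < ε)
    (hε2 : ε ≤ 1 / 2) :
    ∃ c > 0, ∀ z : ℂ, 1 / 2 ≤ ‖z‖ → ‖z‖ < 1 →
      ENNReal.ofReal (c * (1 - ‖z‖) ^ (α + 2))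
        ≤ mu α β (Metric.ball z (ε * (1 - ‖z‖))) := by
  have hpi := Real.pi_pos
  have hB := ProbabilityTheory.beta_pos (show 0 < α + 1 by linarith) (show 0 < β + 1 by linarith)
  set B := ProbabilityTheory.beta (α + 1) (β + 1) with hBdef
  -- On the ball `δ/2 ≤ 1-|ζ|² ≤ 3δ`; which end bounds the `α`-th power from below depends on the
  -- sign of `α`.
  set m : ℝ := min ((1 / 2) ^ α) (3 ^ α) with hm
  have hm0 : 0 < m := by positivity
  refine ⟨m / (Real.pi * B) * (ε ^ 2 * Real.pi), by positivity, fun z hz hz1 => ?_⟩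
  set δ := 1 - ‖z‖ with hδ
  have hδ0 : 0 < δ := by linarith
  set U := Metric.ball z (ε * δ)
  have hball : ∀ ζ ∈ U, 0 < ‖ζ‖ ∧ ‖ζ‖ < 1 ∧ δ / 2 ≤ 1 - ‖ζ‖ ^ 2 ∧ 1 - ‖ζ‖ ^ 2 ≤ 3 * δ := by
    intro ζ hζ
    have h1 : ‖ζ - z‖ < ε * δ := by
      rw [← dist_eq_norm]; exact Metric.mem_ball.1 hζ
    have h2 : ε * δ ≤ 1 / 2 * δ := by gcongr
    have h3 := abs_le.1 (abs_norm_sub_norm_le ζ z)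
    have h4 : ‖ζ‖ < 1 := by linarith
    refine ⟨by linarith, h4, ?_, ?_⟩ <;> nlinarith [norm_nonneg ζ]
  have hUd : U ⊆ disc := fun ζ hζ => (hball ζ hζ).2.1
  have hUm : MeasurableSet U := Metric.isOpen_ball.measurableSet
  have hdens : ∀ ζ ∈ U, m / (Real.pi * B) * δ ^ α ≤ density α β ζ := by
    intro ζ hζ
    obtain ⟨h0, h4, h5, h6⟩ := hball ζ hζ
    have hb : 1 ≤ ‖ζ‖ ^ (2 * β) :=
      Real.one_le_rpow_of_pos_of_le_one_of_nonpos h0 h4.le (by linarith)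
    have hp : 0 < 1 - ‖ζ‖ ^ 2 := by linarith
    have ha : m * δ ^ α ≤ (1 - ‖ζ‖ ^ 2) ^ α := by
      rcases le_total 0 α with h | h
      · calc m * δ ^ α ≤ (1 / 2) ^ α * δ ^ α := by gcongr; exact min_le_left _ _
          _ = (δ / 2) ^ α := by rw [← Real.mul_rpow (by norm_num) hδ0.le]; ring_nf
          _ ≤ _ := Real.rpow_le_rpow (by positivity) h5 h
      · calc m * δ ^ α ≤ 3 ^ α * δ ^ α := by gcongr; exact min_le_right _ _
          _ = (3 * δ) ^ α := by rw [← Real.mul_rpow (by norm_num) hδ0.le]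
          _ ≤ _ := Real.rpow_le_rpow_of_nonpos hp h6 h
    unfold density
    rw [← hBdef]
    calc m / (Real.pi * B) * δ ^ α = 1 * (m * δ ^ α) / (Real.pi * B) := by ring
      _ ≤ ‖ζ‖ ^ (2 * β) * (1 - ‖ζ‖ ^ 2) ^ α / (Real.pi * B) := by gcongr
  have hvol : volume U = ENNReal.ofReal ((ε * δ) ^ 2 * Real.pi) := by
    rw [Complex.volume_ball, ENNReal.ofReal_mul (p := (ε * δ) ^ 2) (by positivity),
      ENNReal.ofReal_pow (by positivity)]
    congr 1
    rw [← NNReal.coe_real_pi, ENNReal.ofReal_coe_nnreal]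
  unfold mu
  rw [withDensity_apply _ hUm, Measure.restrict_restrict hUm, inter_eq_left.2 hUd]
  calc ENNReal.ofReal (m / (Real.pi * B) * (ε ^ 2 * Real.pi) * δ ^ (α + 2))
      = ENNReal.ofReal (m / (Real.pi * B) * δ ^ α) * volume U := by
        rw [hvol, ← ENNReal.ofReal_mul (by positivity)]
        congr 1
        rw [show α + 2 = α + (2 : ℕ) by norm_num, Real.rpow_add_natCast hδ0.ne']
        ring
    _ = ∫⁻ _ in U, ENNReal.ofReal (m / (Real.pi * B) * δ ^ α) := by simp
    _ ≤ _ := setLIntegral_mono' hUm fun ζ hζ => ENNReal.ofReal_le_ofReal (hdens ζ hζ)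

/-! ### The test functions. -/

/-- The test function `(1 - |z|)^{1/q} (1 - z̄ w)^{-(α+3)/q}`, as a function of `w ∈ 𝔻*`. -/
def testFun (α q : ℝ) (z : ℂ) : ℂ → ℂ :=
  puncturedDisc.indicator fun w =>
    (((1 - ‖z‖) ^ (1 / q) : ℝ) : ℂ) * (1 - star z * w) ^ ((-(α + 3) / q : ℝ) : ℂ)

theorem one_sub_norm_le_norm_one_sub_mul {z w : ℂ} (hz : ‖z‖ ≤ 1) :
    1 - ‖w‖ ≤ ‖1 - star z * w‖ := by
  have h := norm_sub_norm_le 1 (star z * w)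
  rw [norm_one, norm_mul, norm_star] at h
  nlinarith [norm_nonneg w]

theorem norm_testFun {α q : ℝ} {z w : ℂ} (hz : ‖z‖ < 1) (hw : w ∈ puncturedDisc) :
    ‖testFun α q z w‖ = (1 - ‖z‖) ^ (1 / q) * ‖1 - star z * w‖ ^ (-(α + 3) / q) := by
  have h0 : 0 < 1 - ‖z‖ := by linarith
  rw [testFun, indicator_of_mem hw, norm_mul, Complex.norm_cpow_real, Complex.norm_real,
    Real.norm_of_nonneg (by positivity)]

/-- The right side is independent of `q`, so one Forelli-Rudin estimate serves every exponent. -/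
theorem enorm_testFun_rpow {α q : ℝ} (hq : 0 < q) {z w : ℂ} (hz : ‖z‖ < 1)
    (hw : w ∈ puncturedDisc) :
    ‖testFun α q z w‖ₑ ^ q
      = ENNReal.ofReal (1 - ‖z‖) * ENNReal.ofReal (‖1 - star z * w‖ ^ (-(α + 3))) := by
  have h0 : 0 < 1 - ‖z‖ := by linarith
  rw [← ofReal_norm, ENNReal.ofReal_rpow_of_nonneg (norm_nonneg _) hq.le, norm_testFun hz hw,
    Real.mul_rpow (by positivity) (by positivity), ← Real.rpow_mul h0.le,
    ← Real.rpow_mul (norm_nonneg _), div_mul_cancel₀ _ hq.ne', div_mul_cancel₀ _ hq.ne',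
    Real.rpow_one, ENNReal.ofReal_mul h0.le]

theorem norm_testFun_le {α q : ℝ} (hα : -1 < α) (hq : 0 < q) {z w : ℂ} (hz : ‖z‖ < 1) {s : ℝ}
    (hs : s < 1) (hw : ‖w‖ ≤ s) :
    ‖testFun α q z w‖ ≤ (1 - ‖z‖) ^ (1 / q) * (1 - s) ^ (-(α + 3) / q) := by
  have h0 : 0 < 1 - ‖z‖ := by linarith
  have h1 : 0 < 1 - s := by linarith
  by_cases hw' : w ∈ puncturedDisc
  · rw [norm_testFun hz hw']
    refine mul_le_mul_of_nonneg_left (Real.rpow_le_rpow_of_nonpos h1 ?_ ?_) (by positivity)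
    · exact le_trans (by linarith) (one_sub_norm_le_norm_one_sub_mul hz.le)
    · exact div_nonpos_of_nonpos_of_nonneg (by linarith) hq.le
  · rw [testFun, indicator_of_notMem hw', norm_zero]
    positivity

theorem differentiableOn_testFun (α q : ℝ) {z : ℂ} (hz : ‖z‖ < 1) :
    DifferentiableOn ℂ (testFun α q z) puncturedDisc := by
  refine DifferentiableOn.congr (f := fun w => (((1 - ‖z‖) ^ (1 / q) : ℝ) : ℂ) *
    (1 - star z * w) ^ ((-(α + 3) / q : ℝ) : ℂ)) ?_ fun w hw => indicator_of_mem hw _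
  refine (DifferentiableOn.cpow_const (by fun_prop) fun w hw => ?_).const_mul _
  rw [sub_eq_add_neg]
  refine Complex.mem_slitPlane_of_norm_lt_one ?_
  rw [norm_neg, norm_mul, norm_star]
  nlinarith [hw.2, norm_nonneg z, hw.1]

theorem measurable_testFun (α q : ℝ) (z : ℂ) : Measurable (testFun α q z) := by
  refine Measurable.indicator ?_ isOpen_puncturedDisc.measurableSet
  have : Measurable fun w : ℂ => (1 - star z * w) ^ ((-(α + 3) / q : ℝ) : ℂ) :=
    Measurable.pow_const (by fun_prop) _
  exact this.const_mul _

/-- The test functions are bounded in `𝒜^q_{α,β}`. -/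
theorem exists_lintegral_testFun_le {α β q : ℝ} (hα : -1 < α) (hβ : -1 < β) (hq : 0 < q) :
    ∃ C : ℝ, 0 < C ∧ ∀ z : ℂ, ‖z‖ < 1 →
      ∫⁻ w, ‖testFun α q z w‖ₑ ^ q ∂(mu α β) ≤ ENNReal.ofReal C := by
  obtain ⟨C, hC0, hC⟩ := exists_lintegral_rpow_le hα hβ
  refine ⟨C, hC0, fun z hz => ?_⟩
  have h0 : 0 < 1 - ‖z‖ := by linarith
  calc ∫⁻ w, ‖testFun α q z w‖ₑ ^ q ∂(mu α β)
      ≤ ∫⁻ w, ENNReal.ofReal (1 - ‖z‖) *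
          ENNReal.ofReal (‖1 - star z * w‖ ^ (-(α + 3))) ∂(mu α β) := by
        refine lintegral_mono fun w => ?_
        by_cases hw : w ∈ puncturedDisc
        · exact (enorm_testFun_rpow hq hz hw).le
        · simp only [testFun, indicator_of_notMem hw, enorm_zero, ENNReal.zero_rpow_of_pos hq,
            zero_le]
    _ ≤ ENNReal.ofReal (1 - ‖z‖) * ENNReal.ofReal (C / (1 - ‖z‖)) := by
        rw [lintegral_const_mul' _ _ ENNReal.ofReal_ne_top]
        gcongr
        exact hC z hz
    _ = ENNReal.ofReal C := by
        rw [← ENNReal.ofReal_mul h0.le]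
        congr 1
        field_simp

theorem testFun_mem_bergmanSubmodule {α β : ℝ} (hα : -1 < α) (hβ : -1 < β) {p : ℝ≥0∞}
    (hp0 : p ≠ 0) (hp : p ≠ ∞) {z : ℂ} (hz : ‖z‖ < 1) :
    testFun α p.toReal z ∈ bergmanSubmodule α β p := by
  refine ⟨differentiableOn_testFun α _ hz, fun w hw => indicator_of_notMem hw _,
    (measurable_testFun α _ z).aestronglyMeasurable, ?_⟩
  obtain ⟨C, -, hC⟩ := exists_lintegral_testFun_le hα hβ (ENNReal.toReal_pos hp0 hp)
  rw [eLpNorm_lt_top_iff_lintegral_rpow_enorm_lt_top hp0 hp]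
  exact (hC z hz).trans_lt ENNReal.ofReal_lt_top

theorem tendsto_one_sub_norm_rpow {u : ℕ → ℂ} (hu : Tendsto (fun n => ‖u n‖) atTop (𝓝 1))
    {a : ℝ} (ha : 0 < a) : Tendsto (fun n => (1 - ‖u n‖) ^ a) atTop (𝓝 0) := by
  have h1 : Tendsto (fun n => 1 - ‖u n‖) atTop (𝓝 0) := by simpa using hu.const_sub 1
  simpa [Real.zero_rpow ha.ne'] using h1.rpow_const (p := a) (Or.inr ha.le)

theorem tendsto_testFun {α q : ℝ} (hα : -1 < α) (hq : 0 < q) {u : ℕ → ℂ}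
    (hu1 : ∀ n, ‖u n‖ < 1) (hu : Tendsto (fun n => ‖u n‖) atTop (𝓝 1)) (w : ℂ) :
    Tendsto (fun n => testFun α q (u n) w) atTop (𝓝 0) := by
  by_cases hw : w ∈ puncturedDisc
  · refine squeeze_zero_norm (fun n => norm_testFun_le hα hq (hu1 n) hw.2 le_rfl) ?_
    simpa using (tendsto_one_sub_norm_rpow hu (one_div_pos.2 hq)).mul_const
      ((1 - ‖w‖) ^ (-(α + 3) / q))
  · simp [testFun, indicator_of_notMem hw]

theorem exists_lt_one_forall_norm_le {g : ℂ → ℂ} (hg : Continuous g) (h0 : ∀ z ∉ disc, g z = 0)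
    {ε : ℝ} (hε : 0 < ε) : ∃ s < 1, ∀ w, s < ‖w‖ → ‖g w‖ ≤ ε := by
  set S := {w : ℂ | ε ≤ ‖g w‖} with hS
  have hSd : S ⊆ disc := fun w hw => by
    by_contra hcon
    have hw' : ε ≤ ‖g w‖ := hw
    rw [h0 w hcon, norm_zero] at hw'
    linarith
  have hSc : IsCompact S := by
    refine (isCompact_closedBall (0 : ℂ) 1).of_isClosed_subset
      (isClosed_le continuous_const hg.norm) fun w hw => ?_
    rw [mem_closedBall_zero_iff]
    exact (hSd hw).le
  rcases S.eq_empty_or_nonempty with h | h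
  · refine ⟨0, one_pos, fun w _ => ?_⟩
    by_contra hcon
    have : w ∈ S := (not_le.1 hcon).le
    rw [h] at this
    exact this
  · obtain ⟨x, hx, hmax⟩ := hSc.exists_isMaxOn h continuous_norm.continuousOn
    refine ⟨‖x‖, hSd hx, fun w hw => ?_⟩
    by_contra hcon
    exact absurd (hmax (not_le.1 hcon).le) (not_le.2 hw)

theorem integral_norm_le_of_lintegral {μ : Measure ℂ} {f : ℂ → ℂ} {C : ℝ} (hC : 0 ≤ C)
    (hf : AEStronglyMeasurable f μ) (h : ∫⁻ w, ‖f w‖ₑ ∂μ ≤ ENNReal.ofReal C) :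
    ∫ w, ‖f w‖ ∂μ ≤ C := by
  rw [integral_norm_eq_lintegral_enorm hf]
  exact ENNReal.toReal_le_of_le_ofReal hC h

/-- For `q = 1` the test functions tend to `0` weak-star as `|z| → 1`. -/
theorem tendsto_integral_testFun_mul {α β : ℝ} (hα : -1 < α) (hβ : -1 < β) {u : ℕ → ℂ}
    (hu1 : ∀ n, ‖u n‖ < 1) (hu : Tendsto (fun n => ‖u n‖) atTop (𝓝 1)) {g : ℂ → ℂ}
    (hg : Continuous g) (h0 : ∀ z ∉ disc, g z = 0) :
    Tendsto (fun n => ∫ w, testFun α 1 (u n) w * g w ∂(mu α β)) atTop (𝓝 0) := by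
  have := isFiniteMeasure_mu hα hβ
  obtain ⟨C, hC0, hC⟩ := exists_lintegral_testFun_le hα hβ (q := 1) one_pos
  obtain ⟨G, hG⟩ := (isCompact_closedBall (0 : ℂ) 1).exists_bound_of_continuousOn hg.continuousOn
  have hG' : ∀ w, ‖g w‖ ≤ max G 0 := fun w => by
    by_cases hw : w ∈ disc
    · exact (hG w (by rw [mem_closedBall_zero_iff]; exact le_of_lt hw)).trans (le_max_left _ _)
    · rw [h0 w hw, norm_zero]
      exact le_max_right _ _
  rw [Metric.tendsto_atTop']
  intro ε hε
  -- For `|w| > s` the smallness of `g` acts against the `L¹` bound `C`, contributing at most `ε/2`;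
  -- for `|w| ≤ s` the test functions tend to `0` uniformly.
  obtain ⟨s, hs, hgs⟩ := exists_lt_one_forall_norm_le hg h0 (show 0 < ε / (2 * C) by positivity)
  set K : ℕ → ℝ := fun n =>
    (1 - ‖u n‖) ^ (1 / 1 : ℝ) * (1 - s) ^ (-(α + 3) / 1) * max G 0 with hK
  have hlim : Tendsto (fun n => K n * (mu α β).real univ) atTop (𝓝 0) := by
    have h := (((tendsto_one_sub_norm_rpow hu (a := 1 / 1) (by norm_num)).mul_const
      ((1 - s) ^ (-(α + 3) / 1))).mul_const (max G 0)).mul_const ((mu α β).real univ)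
    simpa only [zero_mul] using h
  obtain ⟨N, hN⟩ := eventually_atTop.1 (hlim.eventually (gt_mem_nhds (show 0 < ε / 2 by positivity)))
  refine ⟨N, fun n hn => ?_⟩
  have hmeas := (measurable_testFun α 1 (u n)).aestronglyMeasurable (μ := mu α β)
  have hl : ∫⁻ w, ‖testFun α 1 (u n) w‖ₑ ∂(mu α β) ≤ ENNReal.ofReal C := by
    simpa using hC (u n) (hu1 n)
  have hint : Integrable (testFun α 1 (u n)) (mu α β) :=
    ⟨hmeas, hl.trans_lt ENNReal.ofReal_lt_top⟩
  have hK0 : 0 ≤ K n := by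
    have := hu1 n
    have h1 : 0 ≤ 1 - ‖u n‖ := by linarith
    have h2 : 0 ≤ 1 - s := by linarith
    positivity
  have hb : ∀ w, ‖testFun α 1 (u n) w * g w‖
      ≤ ε / (2 * C) * ‖testFun α 1 (u n) w‖ + K n := fun w => by
    rw [norm_mul]
    rcases le_or_gt ‖w‖ s with hw | hw
    · calc ‖testFun α 1 (u n) w‖ * ‖g w‖ ≤ K n := by
            have h1 := norm_testFun_le hα one_pos (hu1 n) hs hw
            exact mul_le_mul h1 (hG' w) (norm_nonneg _) ((norm_nonneg _).trans h1)
        _ ≤ _ := le_add_of_nonneg_left (by positivity)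
    · calc ‖testFun α 1 (u n) w‖ * ‖g w‖ ≤ ‖testFun α 1 (u n) w‖ * (ε / (2 * C)) := by
            gcongr
            exact hgs w hw
        _ = ε / (2 * C) * ‖testFun α 1 (u n) w‖ := mul_comm _ _
        _ ≤ _ := le_add_of_nonneg_right hK0
  rw [dist_zero_right]
  calc ‖∫ w, testFun α 1 (u n) w * g w ∂(mu α β)‖
      ≤ ∫ w, (ε / (2 * C) * ‖testFun α 1 (u n) w‖ + K n) ∂(mu α β) :=
        norm_integral_le_of_norm_le ((hint.norm.const_mul _).add (integrable_const _))
          (Eventually.of_forall hb)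
    _ = ε / (2 * C) * ∫ w, ‖testFun α 1 (u n) w‖ ∂(mu α β) + K n * (mu α β).real univ := by
        rw [integral_add (hint.norm.const_mul _) (integrable_const _), integral_const_mul,
          integral_const, smul_eq_mul, mul_comm (K n)]
    _ ≤ ε / (2 * C) * C + K n * (mu α β).real univ := by
        gcongr
        exact integral_norm_le_of_lintegral hC0.le hmeas hl
    _ < ε := by
        have h1 := hN n (le_of_lt hn)
        have h2 : ε / (2 * C) * C = ε / 2 := by field_simp
        linarith

/-! ### From the vanishing Carleson property to decay of integrals against `ν`. -/

/-- A compact inclusion maps a bounded sequence that tends to `0` pointwise to a null sequence. -/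
theorem tendsto_norm_inclusion_of_isCompactOperator {α β : ℝ} {p : ℝ≥0∞} [Fact (1 ≤ p)]
    {ν : Measure ℂ} {h : IsIncluded α β p ν} (hc : IsCompactOperator (inclusion h))
    {f : ℕ → BergmanSpace α β p} {C : ℝ} (hb : ∀ n, ‖f n‖ ≤ C)
    (hf : ∀ w, Tendsto (fun n => f n w) atTop (𝓝 0)) :
    Tendsto (fun n => ‖inclusion h (f n)‖) atTop (𝓝 0) := by
  obtain ⟨K, hK, hKs⟩ := hc.image_closedBall_subset_compact C
  refine tendsto_of_subseq_tendsto fun ns hns => ?_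
  obtain ⟨y, -, φ, hφ, hy⟩ := hK.tendsto_subseq (x := fun n => inclusion h (f (ns n)))
    fun n => hKs ⟨_, mem_closedBall_zero_iff.2 (hb _), rfl⟩
  refine ⟨φ, ?_⟩
  suffices h0 : y = 0 by
    rw [h0] at hy
    simpa using hy.norm
  -- A further subsequence converges almost everywhere to `y`, and pointwise to `0`; this identifies
  -- the limit.
  obtain ⟨ψ, hψ, hae⟩ := (tendstoInMeasure_of_tendsto_Lp hy).exists_seq_tendsto_ae
  have hcoe : ∀ᵐ w ∂(ν.restrict puncturedDisc), ∀ n, inclusion h (f n) w = f n w :=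
    ae_all_iff.2 fun n => (h (f n)).coeFn_toLp
  have hlim : Tendsto (fun n => ns (φ (ψ n))) atTop atTop :=
    hns.comp (hφ.tendsto_atTop.comp hψ.tendsto_atTop)
  refine (Lp.eq_zero_iff_ae_eq_zero).2 ?_
  filter_upwards [hae, hcoe] with w hw1 hw2
  refine tendsto_nhds_unique hw1 (((hf w).comp hlim).congr fun n => ?_)
  exact (hw2 _).symm

theorem eLpNorm_rpow_toReal {μ : Measure ℂ} {p : ℝ≥0∞} (hp0 : p ≠ 0) (hp : p ≠ ∞) (f : ℂ → ℂ) :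
    eLpNorm f p μ ^ p.toReal = ∫⁻ w, ‖f w‖ₑ ^ p.toReal ∂μ := by
  rw [eLpNorm_eq_lintegral_rpow_enorm_toReal hp0 hp, ← ENNReal.rpow_mul,
    one_div_mul_cancel (ENNReal.toReal_pos hp0 hp).ne', ENNReal.rpow_one]

theorem tendsto_lintegral_testFun {α β : ℝ} (hα : -1 < α) (hβ : -1 < β) {p : ℝ≥0∞}
    [Fact (1 ≤ p)] (hp : p ≠ ∞) {ν : Measure ℂ} (hν : IsVanishingCarleson α β p ν) {u : ℕ → ℂ}
    (hu1 : ∀ n, ‖u n‖ < 1) (hu : Tendsto (fun n => ‖u n‖) atTop (𝓝 1)) :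
    Tendsto (fun n => ∫⁻ w in puncturedDisc, ‖testFun α p.toReal (u n) w‖ₑ ^ p.toReal ∂ν) atTop
      (𝓝 0) := by
  obtain ⟨h, h1, h2⟩ := hν
  have hp1 : 1 ≤ p := Fact.out
  have hp0 : p ≠ 0 := (zero_lt_one.trans_le hp1).ne'
  have hq : 0 < p.toReal := ENNReal.toReal_pos hp0 hp
  let f : ℕ → BergmanSpace α β p := fun n =>
    ⟨testFun α p.toReal (u n), testFun_mem_bergmanSubmodule hα hβ hp0 hp (hu1 n)⟩
  have hnorm : Tendsto (fun n => ‖inclusion h (f n)‖) atTop (𝓝 0) := by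
    rcases hp1.lt_or_eq with hlt | heq
    · obtain ⟨C, hC0, hC⟩ := exists_lintegral_testFun_le hα hβ hq
      refine tendsto_norm_inclusion_of_isCompactOperator (h1 hlt) (C := C ^ (1 / p.toReal))
        (fun n => ?_) fun w => tendsto_testFun hα hq hu1 hu w
      rw [norm_def]
      refine ENNReal.toReal_le_of_le_ofReal (by positivity) ?_
      rw [eLpNorm_eq_lintegral_rpow_enorm_toReal hp0 hp,
        ← ENNReal.ofReal_rpow_of_nonneg hC0.le (by positivity)]
      gcongr
      exact hC (u n) (hu1 n)
    · subst heq
      refine h2 rfl f fun g hg => ?_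
      have := tendsto_integral_testFun_mul hα hβ hu1 hu g.continuous hg
      simpa only [f, ENNReal.toReal_one] using this
  have he : ∀ n, ∫⁻ w in puncturedDisc, ‖testFun α p.toReal (u n) w‖ₑ ^ p.toReal ∂ν
      = ENNReal.ofReal (‖inclusion h (f n)‖ ^ p.toReal) := fun n => by
    rw [← eLpNorm_rpow_toReal hp0 hp, ← ENNReal.ofReal_rpow_of_nonneg (norm_nonneg _) hq.le]
    congr 1
    have e : ‖inclusion h (f n)‖ = (eLpNorm (f n) p (ν.restrict puncturedDisc)).toReal :=
      Lp.norm_toLp _ (h (f n))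
    rw [e, ENNReal.ofReal_toReal (h (f n)).2.ne]
  simp_rw [he]
  have h3 := hnorm.rpow_const (p := p.toReal) (Or.inr hq.le)
  rw [Real.zero_rpow hq.ne'] at h3
  simpa using ENNReal.tendsto_ofReal h3

/-- From `1 - z̄w = (1-|z|²) - z̄(w-z)` and `1-|z|² ≤ 2(1-|z|)`. -/
theorem norm_one_sub_mul_le {z w : ℂ} {M : ℝ} (hz : ‖z‖ < 1)
    (hw : ‖w - z‖ < M * (1 - ‖z‖)) : ‖1 - star z * w‖ ≤ (2 + M) * (1 - ‖z‖) := by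
  have e : 1 - star z * w = ((1 - ‖z‖ ^ 2 : ℝ) : ℂ) - star z * (w - z) := by
    have : star z * z = ((‖z‖ ^ 2 : ℝ) : ℂ) := by
      rw [mul_comm, Complex.star_def, Complex.mul_conj, Complex.normSq_eq_norm_sq]
    rw [mul_sub, this]
    push_cast
    ring
  have hz0 := norm_nonneg z
  rw [e]
  refine (norm_sub_le _ _).trans ?_
  rw [Complex.norm_real, Real.norm_of_nonneg (by nlinarith), norm_mul, norm_star]
  have h1 : ‖z‖ * ‖w - z‖ ≤ 1 * (M * (1 - ‖z‖)) := by gcongr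
  nlinarith

/-- A Chebyshev inequality: on the disc of radius `M(1-|z|)` the `q`-th power of the test function
is at least the displayed constant. -/
theorem ofReal_mul_measure_le_lintegral_testFun {α q M : ℝ} (hα : -1 < α) (hq : 0 < q)
    (hM : 0 < M) (ν : Measure ℂ) {z : ℂ} (hz : ‖z‖ < 1) :
    ENNReal.ofReal ((2 + M) ^ (-(α + 3)) * (1 - ‖z‖) ^ (-(α + 2))) *
        ν (puncturedDisc ∩ Metric.ball z (M * (1 - ‖z‖)))
      ≤ ∫⁻ w in puncturedDisc, ‖testFun α q z w‖ₑ ^ q ∂ν := by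
  set δ := 1 - ‖z‖ with hδ
  have hδ0 : 0 < δ := by linarith
  set E := puncturedDisc ∩ Metric.ball z (M * δ)
  have hEm : MeasurableSet E :=
    isOpen_puncturedDisc.measurableSet.inter Metric.isOpen_ball.measurableSet
  calc _ = ∫⁻ _ in E, ENNReal.ofReal ((2 + M) ^ (-(α + 3)) * δ ^ (-(α + 2))) ∂ν := by simp
    _ ≤ ∫⁻ w in E, ‖testFun α q z w‖ₑ ^ q ∂ν := by
      refine setLIntegral_mono' hEm fun w hw => ?_
      rw [enorm_testFun_rpow hq hz hw.1, ← ENNReal.ofReal_mul hδ0.le]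
      apply ENNReal.ofReal_le_ofReal
      have h1 := norm_one_sub_mul_le hz (by rw [← dist_eq_norm]; exact Metric.mem_ball.1 hw.2)
      have h2 : 0 < ‖1 - star z * w‖ :=
        (sub_pos.2 hw.1.2).trans_le (one_sub_norm_le_norm_one_sub_mul hz.le)
      calc (2 + M) ^ (-(α + 3)) * δ ^ (-(α + 2)) = δ * ((2 + M) * δ) ^ (-(α + 3)) := by
            rw [Real.mul_rpow (by positivity) hδ0.le,
              show -(α + 2) = -(α + 3) + 1 by ring, Real.rpow_add_one hδ0.ne']
            ring
        _ ≤ δ * ‖1 - star z * w‖ ^ (-(α + 3)) :=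
          mul_le_mul_of_nonneg_left (Real.rpow_le_rpow_of_nonpos h2 h1 (by linarith)) hδ0.le
    _ ≤ _ := lintegral_mono_set inter_subset_left

end ModifiedBergman

end

/-! ### The quotient of the two measures. -/

theorem mainTheorem7 (α β : ℝ) (hα : -1 < α) (hβ : β ∈ ModifiedBergman.J α)
    (p : ℝ≥0∞) [Fact (1 ≤ p)] (hp : p ≠ ∞) (r : ℝ) (hr : 0 < r) (ν : Measure ℂ)
    (hν : ModifiedBergman.IsVanishingCarleson α β p ν) :
    Tendsto
      (fun z : ℂ => ν (ModifiedBergman.bergmanDisc α β z r) /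
        ModifiedBergman.mu α β (ModifiedBergman.bergmanDisc α β z r))
      (comap (fun z : ℂ => ‖z‖) (𝓝[<] 1)) (𝓝 0) := by
  obtain ⟨h1, hβ0, -⟩ := hβ
  obtain ⟨ε, R₁, hε, hε2, hR₁, hsub⟩ :=
    ModifiedBergman.exists_ball_subset_bergmanDisc hα h1 hβ0 hr
  obtain ⟨M, R₂, hM, hR₂, hsup⟩ := ModifiedBergman.exists_bergmanDisc_subset_ball hα h1 hβ0 hr
  obtain ⟨c, hc, hmu⟩ := ModifiedBergman.exists_le_mu_ball hα h1 hβ0 hε hε2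
  have hp0 : p ≠ 0 := (zero_lt_one.trans_le (Fact.out : 1 ≤ p)).ne'
  have hq : 0 < p.toReal := ENNReal.toReal_pos hp0 hp
  -- The filter is countably generated, so sequences suffice, matching the sequential form of the
  -- vanishing property.
  refine tendsto_of_seq_tendsto fun u hu => ?_
  rw [tendsto_comap_iff] at hu
  have hu1 : Tendsto (fun n => ‖u n‖) atTop (𝓝 1) := hu.mono_right nhdsWithin_le_nhds
  have hev : ∀ᶠ n in atTop, ‖u n‖ ∈ Ioo (max (max R₁ R₂) (1 / 2)) 1 :=
    hu.eventually (Ioo_mem_nhdsLT (max_lt (max_lt hR₁ hR₂) (by norm_num)))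
  obtain ⟨N, hN⟩ := eventually_atTop.1 hev
  rw [← tendsto_add_atTop_iff_nat N]
  set v : ℕ → ℂ := fun n => u (n + N) with hv
  have hv0 : ∀ n, ‖v n‖ ∈ Ioo (max (max R₁ R₂) (1 / 2)) 1 := fun n => hN _ (by omega)
  have hv1 : Tendsto (fun n => ‖v n‖) atTop (𝓝 1) := (tendsto_add_atTop_iff_nat N).2 hu1
  have hlim := ModifiedBergman.tendsto_lintegral_testFun hα h1 hp hν (fun n => (hv0 n).2) hv1
  set k : ℝ := (2 + M) ^ (-(α + 3)) with hk
  have hk0 : 0 < k := by positivity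
  have hlim' := ENNReal.Tendsto.const_mul (a := ENNReal.ofReal (1 / (k * c))) hlim
    (Or.inr ENNReal.ofReal_ne_top)
  rw [mul_zero] at hlim'
  refine tendsto_of_tendsto_of_tendsto_of_le_of_le tendsto_const_nhds hlim' (fun _ => zero_le)
    fun n => ENNReal.div_le_of_le_mul ?_
  have hmax := (hv0 n).1
  have hR₁' : R₁ ≤ ‖v n‖ := ((le_max_left _ _).trans (le_max_left _ _)).trans hmax.le
  have hR₂' : R₂ ≤ ‖v n‖ := ((le_max_right _ _).trans (le_max_left _ _)).trans hmax.le
  have hhalf : 1 / 2 ≤ ‖v n‖ := (le_max_right _ _).trans hmax.le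
  have hlt := (hv0 n).2
  have hδ : 0 < 1 - ‖v n‖ := by linarith
  have hA := ModifiedBergman.ofReal_mul_measure_le_lintegral_testFun (α := α) hα hq hM ν hlt
  have hB := (hmu (v n) hhalf hlt).trans (measure_mono (hsub (v n) hR₁' hlt))
  have hC : ν (ModifiedBergman.bergmanDisc α β (v n) r)
      ≤ ν (ModifiedBergman.puncturedDisc ∩ Metric.ball (v n) (M * (1 - ‖v n‖))) :=
    measure_mono fun w hw => ⟨hw.1, hsup (v n) hR₂' hlt hw⟩
  -- The lower bound for `μ` and that for the test function carry opposite powers of `1-|z|`, so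
  -- only `1/(kc)` survives.
  have hone : ENNReal.ofReal (1 / (k * c)) * ENNReal.ofReal (c * (1 - ‖v n‖) ^ (α + 2)) *
      ENNReal.ofReal (k * (1 - ‖v n‖) ^ (-(α + 2))) = 1 := by
    rw [← ENNReal.ofReal_mul (by positivity), ← ENNReal.ofReal_mul (by positivity),
      ← ENNReal.ofReal_one]
    congr 1
    rw [Real.rpow_neg hδ.le]
    field_simp
  calc ν (ModifiedBergman.bergmanDisc α β (v n) r)
      ≤ 1 * ν (ModifiedBergman.puncturedDisc ∩ Metric.ball (v n) (M * (1 - ‖v n‖))) := by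
        rw [one_mul]; exact hC
    _ = ENNReal.ofReal (1 / (k * c)) * ENNReal.ofReal (c * (1 - ‖v n‖) ^ (α + 2)) *
          (ENNReal.ofReal (k * (1 - ‖v n‖) ^ (-(α + 2))) *
            ν (ModifiedBergman.puncturedDisc ∩ Metric.ball (v n) (M * (1 - ‖v n‖)))) := by
        rw [← hone, mul_assoc]
    _ ≤ ENNReal.ofReal (1 / (k * c)) *
          ModifiedBergman.mu α β (ModifiedBergman.bergmanDisc α β (v n) r) *
          ∫⁻ w in ModifiedBergman.puncturedDisc,
            ‖ModifiedBergman.testFun α p.toReal (v n) w‖ₑ ^ p.toReal ∂ν := by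
        gcongr
    _ = _ := mul_right_comm _ _ _
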